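/- **Theorem 3.1.** Equip $\mathbb R^3$ with $\langle x,y\rangle=-x_0y_0+x_1y_1+x_2y_2$ and $\|x\|=\sqrt{|\langle x,x\rangle|}$, let $a\wedge b$ be the formal determinant with rows $(-e_0,e_1,e_2)$, $a$, $b$, and put $H^2(-1)=\{\langle x,x\rangle=-1\}$, $S^2_1=\{\langle x,x\rangle=1\}$, $LC^*=\{x\neq 0,\ \langle x,x\rangle=0\}$. Let $U\subset\mathbb R^2$ be open and let $X:U\to\mathbb R^3_1$ be a smooth embedding all of whose nonzero tangent vectors are spacelike ($\langle v,v\rangle>0$), oriented so that the unit normal $n=X_{u_1}\wedge X_{u_2}/\|X_{u_1}\wedge X_{u_2}\|$ is future directed, i.e. $\langle n,e_0\rangle<0$. Let $I$ be an open interval, $\bar\gamma:I\to U$ a smooth curve such that $\gamma=X\circ\bar\gamma$ has unit speed, $\langle\gamma',\gamma'\rangle=1$. Put $$t=\gamma',\quad n_\gamma=n\circ\bar\gamma,\quad b=t\wedge n_\gamma,\quad \kappa_n=-\langle t',n_\gamma\rangle,\quad \kappa_g=\langle t',b\rangle,\quad \tau_g=-\langle b',n_\gamma\rangle,$$ and assume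 $\|t'(s)\|\ne0$ and $\|b'(s)\|\neq 0$ for all $s\in I$. Consider, on the open sets of parameters where they are defined, the following images $D$, with values in the indicated surfaces $Q$, and invariants $\delta$: * (A) where $\kappa_g^2>\tau_g^2$: $D^T_r=\dfrac{\tau_g t-\kappa_g n_\gamma}{\sqrt{\kappa_g^2-\tau_g^2}}\in H^2(-1)$, $\ \delta^T_r=\kappa_n-\dfrac{\kappa_g\tau_g'-\kappa_g'\tau_g}{\kappa_g^2-\tau_g^2}$; * (B) where $\tau_g^2>\kappa_g^2$: $D^S_r=\dfrac{\tau_g t-\kappa_g n_\gamma}{\sqrt{\tau_g^2-\kappa_g^2}}\in S^2_1$, $\ \delta^S_r=\kappa_n+\dfrac{\kappa_g\tau_g'-\kappa_g'\tau_g}{\tau_g^2-\kappa_g^2}$; * (C) where $\kappa_g^2>\tau_g^2$: $D^L_r=D^T_r+b\in LC^*$, $\ \delta^L_r=\delta^T_r+\sqrt{\kappa_g^2-\tau_g^2}$; * (D) where $(\kappa_n,\tau_g)\neq(0,0)$: $D^S_o=\dfrac{\tau_g t-\kappa_n b}{\sqrt{\kappa_n^2+\tau_g^2}}\in S^2_1$,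 $\ \delta^S_o=\kappa_g+\dfrac{\kappa_n\tau_g'-\kappa_n'\tau_g}{\kappa_n^2+\tau_g^2}$; * (E) where $(\kappa_n,\tau_g)\neq(0,0)$: $D^L_o=D^S_o+n_\gamma\in LC^*$, $\ \delta^L_o=\delta^S_o+\sqrt{\kappa_n^2+\tau_g^2}$. Let $s_0\in I$. In each of the five cases, if the defining condition of the case holds at $s_0$, then: 1. $D$ is non-singular at $s_0$ (that is, $D'(s_0)\ne0$) if and only if $\delta(s_0)\neq0$; 2. the image of $D$ is locally diffeomorphic to the ordinary cusp $C=\{(x_1,x_2)\in\mathbb R^2 : x_1^2=x_2^3\}$ at $s_0$ if and only if $\delta(s_0)=0$ and $\delta'(s_0)\neq0$. Here the condition in 2 means: for all sufficiently small $\varepsilon>0$ there is a smooth diffeomorphism from an open neighbourhood $W$ of $0$ in $\mathbb R^2$ onto an open neighbourhood of $D(s_0)$ in $Q$, taking $0$ to $D(s_0)$, that maps $C\cap W$ onto the part of $D((s_0-\varepsilon,s_0+\varepsilon))$ lying in that neighbourhood. -/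

import Mathlib

open scoped ContDiff Topology

noncomputable section

namespace LorentzDarboux

/-- The underlying vector space of Lorentz-Minkowski 3-space, with coordinates `(x 0, x 1, x 2)`,
`x 0` being the time coordinate. Only its smooth structure and `lip` below are used. -/
abbrev R31 : Type := Fin 3 → ℝ

/-- The plane. -/
abbrev R2 : Type := Fin 2 → ℝ

/-- The pseudo-scalar product `-x₀y₀ + x₁y₁ + x₂y₂`. -/
def lip (x y : R31) : ℝ := -(x 0 * y 0) + x 1 * y 1 + x 2 * y 2

/-- The pseudo-norm `√|⟨x, x⟩|`. -/
def pnorm (x : R31) : ℝ := √|lip x x|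

/-- The canonical timelike basis vector `e₀`. -/
def e0 : R31 := ![1, 0, 0]

/-- The Lorentzian vector product: the formal determinant with rows `(-e₀, e₁, e₂)`, `a`, `b`. -/
def wedge (a b : R31) : R31 :=
  ![-(a 1 * b 2 - a 2 * b 1), -(a 0 * b 2 - a 2 * b 0), a 0 * b 1 - a 1 * b 0]

/-- The hyperbolic plane `H²(-1)`. -/
def hyperbolicPlane : Set R31 := {x | lip x x = -1}

/-- De Sitter 2-space `S²₁`. -/
def deSitter : Set R31 := {x | lip x x = 1}

/-- The open lightcone `LC*`. -/
def lightcone : Set R31 := {x | x ≠ 0 ∧ lip x x = 0}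

/-- The partial derivative of `X` at `u` with respect to the `i`-th coordinate. -/
def partialD (X : R2 → R31) (i : Fin 2) (u : R2) : R31 := fderiv ℝ X u (Pi.single i 1)

/-- The unit normal `X_{u₁} ∧ X_{u₂} / ‖X_{u₁} ∧ X_{u₂}‖` of a parametrized surface. -/
def unitNormal (X : R2 → R31) (u : R2) : R31 :=
  (pnorm (wedge (partialD X 0 u) (partialD X 1 u)))⁻¹ • wedge (partialD X 0 u) (partialD X 1 u)

/-- A spacelike surface `M = X(U)`, given by a smooth spacelike embedding `X` of an open subset
`U` of the plane, oriented so that its unit normal is future directed. -/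
structure SpacelikeSurface where
  U : Set R2
  X : R2 → R31
  isOpen_U : IsOpen U
  smooth : ContDiffOn ℝ ∞ X U
  embedding : Topology.IsEmbedding (U.domRestrict X)
  /-- All nonzero tangent vectors are spacelike (in particular `X` is an immersion). -/
  spacelike : ∀ u ∈ U, ∀ w : R2, w ≠ 0 → 0 < lip (fderiv ℝ X u w) (fderiv ℝ X u w)
  future_directed : ∀ u ∈ U, lip (unitNormal X u) e0 < 0

/-- A smooth unit speed curve `γ = X ∘ γbar : I → M` on a spacelike surface, `I` an open
interval. Unit speed contains the regularity of `γbar`. -/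
structure UnitSpeedCurve (M : SpacelikeSurface) where
  I : Set ℝ
  γbar : ℝ → R2
  isOpen_I : IsOpen I
  ordConnected_I : I.OrdConnected
  smooth : ContDiffOn ℝ ∞ γbar I
  mapsTo : Set.MapsTo γbar I M.U
  unit_speed : ∀ s ∈ I, lip (deriv (fun r => M.X (γbar r)) s) (deriv (fun r => M.X (γbar r)) s) = 1

namespace UnitSpeedCurve

variable {M : SpacelikeSurface} (c : UnitSpeedCurve M)

/-- The curve in Lorentz-Minkowski space. -/
def γ (s : ℝ) : R31 := M.X (c.γbar s)

/-! The Lorentzian Darboux frame `t`, `n`, `b`. -/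

/-- The unit tangent vector. -/
def t (s : ℝ) : R31 := deriv c.γ s

/-- The unit normal of the surface along the curve. -/
def n (s : ℝ) : R31 := unitNormal M.X (c.γbar s)

/-- The vector `b = t ∧ n`. -/
def b (s : ℝ) : R31 := wedge (c.t s) (c.n s)

/-- `κ_n = -⟨t′, n⟩`. -/
def κn (s : ℝ) : ℝ := -lip (deriv c.t s) (c.n s)

/-- `κ_g = ⟨t′, b⟩`. -/
def κg (s : ℝ) : ℝ := lip (deriv c.t s) (c.b s)

/-- `τ_g = -⟨b′, n⟩`. -/
def τg (s : ℝ) : ℝ := -lip (deriv c.b s) (c.n s)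

/-! The five pseudo-spherical Lorentzian Darboux images. The first letter after `D` is the type
(timelike, spacelike, lightlike), the second one stands for rectifying or osculating.
`DTr` and `DLr` are meaningful where `κ_g² > τ_g²`, `DSr` where `τ_g² > κ_g²`, and `DSo` and `DLo`
where `(κ_n, τ_g) ≠ (0, 0)`; the same holds for the invariants `δ` below. -/

/-- The rectifying timelike Darboux image. -/
def DTr (s : ℝ) : R31 := (√(c.κg s ^ 2 - c.τg s ^ 2))⁻¹ • (c.τg s • c.t s - c.κg s • c.n s)

/-- The rectifying spacelike Darboux image. -/
def DSr (s : ℝ) : R31 := (√(c.τg s ^ 2 - c.κg s ^ 2))⁻¹ • (c.τg s • c.t s - c.κg s • c.n s)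

/-- The rectifying lightlike Darboux image. -/
def DLr (s : ℝ) : R31 :=
  (√(c.κg s ^ 2 - c.τg s ^ 2))⁻¹ • (c.τg s • c.t s - c.κg s • c.n s) + c.b s

/-- The osculating spacelike Darboux image. -/
def DSo (s : ℝ) : R31 := (√(c.κn s ^ 2 + c.τg s ^ 2))⁻¹ • (c.τg s • c.t s - c.κn s • c.b s)

/-- The osculating lightlike Darboux image. -/
def DLo (s : ℝ) : R31 :=
  (√(c.κn s ^ 2 + c.τg s ^ 2))⁻¹ • (c.τg s • c.t s - c.κn s • c.b s) + c.n s

/-! The five invariants. -/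

/-- The invariant of the rectifying timelike image. -/
def δTr (s : ℝ) : ℝ :=
  c.κn s - (c.κg s * deriv c.τg s - deriv c.κg s * c.τg s) / (c.κg s ^ 2 - c.τg s ^ 2)

/-- The invariant of the rectifying spacelike image. -/
def δSr (s : ℝ) : ℝ :=
  c.κn s + (c.κg s * deriv c.τg s - deriv c.κg s * c.τg s) / (c.τg s ^ 2 - c.κg s ^ 2)

/-- The invariant of the rectifying lightlike image. -/
def δLr (s : ℝ) : ℝ :=
  c.κn s - (c.κg s * deriv c.τg s - deriv c.κg s * c.τg s) / (c.κg s ^ 2 - c.τg s ^ 2)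
    + √(c.κg s ^ 2 - c.τg s ^ 2)

/-- The invariant of the osculating spacelike image. -/
def δSo (s : ℝ) : ℝ :=
  c.κg s + (c.κn s * deriv c.τg s - deriv c.κn s * c.τg s) / (c.κn s ^ 2 + c.τg s ^ 2)

/-- The invariant of the osculating lightlike image. -/
def δLo (s : ℝ) : ℝ :=
  c.κg s + (c.κn s * deriv c.τg s - deriv c.κn s * c.τg s) / (c.κn s ^ 2 + c.τg s ^ 2)
    + √(c.κn s ^ 2 + c.τg s ^ 2)

end UnitSpeedCurve

/-- A curve is non-singular at `s₀` if its velocity does not vanish there. -/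
def NonSingularAt (D : ℝ → R31) (s₀ : ℝ) : Prop := deriv D s₀ ≠ 0

/-- The ordinary cusp `x₁² = x₂³` in the plane. -/
def cusp : Set R2 := {x | x 0 ^ 2 = x 1 ^ 3}

/-- The set `A` on the surface `Q` is, near `p`, locally diffeomorphic to the ordinary cusp near
the origin: there is a diffeomorphism `φ`, with inverse `ψ`, of an open neighbourhood `W` of the
origin in the plane onto a neighbourhood `Q ∩ V` of `p` in `Q` that sends the origin to `p` and
the part of the cusp in `W` onto the part of `A` in `V`. -/
def LocallyCusp (Q A : Set R31) (p : R31) : Prop :=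
  ∃ (W : Set R2) (V : Set R31) (φ : R2 → R31) (ψ : R31 → R2),
    IsOpen W ∧ IsOpen V ∧ 0 ∈ W ∧ φ 0 = p ∧
    ContDiffOn ℝ ∞ φ W ∧ ContDiffOn ℝ ∞ ψ V ∧
    φ '' W = Q ∩ V ∧ (∀ x ∈ W, ψ (φ x) = x) ∧
    φ '' (cusp ∩ W) = A ∩ V

/-- The image of the curve `D` on the surface `Q` is locally diffeomorphic to the ordinary cusp at
`s₀`: the image of every sufficiently small interval around `s₀` is so at `D s₀`. (Restricting
to small intervals discards other branches of the curve through the point `D s₀`.) -/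
def ImageLocallyCuspAt (Q : Set R31) (D : ℝ → R31) (s₀ : ℝ) : Prop :=
  ∀ᶠ ε in 𝓝[>] (0 : ℝ), LocallyCusp Q (D '' Set.Ioo (s₀ - ε) (s₀ + ε)) (D s₀)

end LorentzDarboux

end

open LorentzDarboux

open LorentzDarboux
open Filter Asymptotics

/-! All five images are handled by one computation. Let `x`, `y`, `z` be the pseudo-orthonormal
Darboux frame in a suitable order, and `D = (τ x - k y) / r + l z`, with `r` the pseudo-norm of `τ x
- k y` and `l` equal to 0 or 1. In the derivative of `τ x - k y` the `z` terms cancel, and since the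
normalized vector has constant square its derivative is a multiple of `e = (τ y - σ k x) / r`.
Moreover `z' = r e`, so adding `z` merely adds `r` to the factor. Hence `D' = δ e`, where `δ` is the
stated invariant. As `⟨e, z⟩ = 0`, one has `⟨e', z⟩ = -⟨e, z'⟩ = ± r ≠ 0`, so `e` and `e'` are
linearly independent (`frame_image_criterion`). What remains concerns any curve with `D' = δ e` and
`e`, `e'` independent on a level surface of the pseudo-scalar square (`imageLocallyCuspAt_iff`): it
is singular exactly at the zeros of `δ`, and its image is a cusp exactly at the simple zeros.

A simple zero gives a cusp. In a graph chart, take coordinates `v` along the acceleration and `u`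
across it. Then `v` has a nondegenerate minimum, so `v = t ^ 2` for a new parameter `t`, and
Whitney's even-odd decomposition gives `u = a (t ^ 2) + t ^ 3 * b (t ^ 2)`. The independence of `e`
and `e'` says that the slope `u' / v'` has nonzero derivative, that is, `b 0 ≠ 0`. So `(p, q) ↦ (a q
+ p * b q, q)` is a local diffeomorphism carrying the standard cusp to the curve. Whitney's
decomposition follows from Borel's lemma and the smoothness of `f √x` for flat `f`.

A cusp gives a simple zero. Let `(u, v)` be the curve in cusp coordinates, so that `u ^ 2 = v ^ 3`,
and let `g` be the image of `e`, so that `(u, v)' = δ g`. A smooth curve in the cusp stops at the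
vertex, hence `δ s₀ = 0`. Differentiating the cusp equation and dividing by `δ` yields `4 g₀ ^ 2 = 9
v g₁ ^ 2`. If `δ' s₀` were also zero, `v` would be `o((s - s₀) ^ 2)`, which makes `g₀` vanish to
second order and contradicts the independence of `g` and `g'`. -/

/-! ### Flat functions, Borel's lemma, and even/odd decomposition of smooth functions -/

/-- A smooth function on the line that vanishes to infinite order at the origin. -/
def IsFlat (f : ℝ → ℝ) : Prop := ContDiff ℝ ∞ f ∧ ∀ n : ℕ, f =o[𝓝 0] fun x : ℝ => x ^ n

theorem taylor_isLittleO_zero {f : ℝ → ℝ} (hf : ContDiff ℝ ∞ f) (n : ℕ) :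
    (fun x => f x - ∑ k ∈ Finset.range (n + 1), iteratedDeriv k f 0 / k.factorial * x ^ k)
      =o[𝓝 0] fun x : ℝ => x ^ n := by
  have h := taylor_isLittleO_univ (x₀ := 0) (n := n) (hf.of_le (by exact_mod_cast le_top))
  simp only [taylor_within_apply, sub_zero, iteratedDerivWithin_univ, smul_eq_mul] at h
  refine h.congr_left fun x => ?_
  congr 1
  exact Finset.sum_congr rfl fun k _ => by ring

/-- Once the coefficients below order `n` vanish, the Taylor estimate makes the monomial of degree
`n` itself `o(x ^ n)`, which forces its coefficient to be zero. -/
theorem isFlat_iff_iteratedDeriv {f : ℝ → ℝ} (hf : ContDiff ℝ ∞ f) :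
    IsFlat f ↔ ∀ n, iteratedDeriv n f 0 = 0 := by
  constructor
  · intro h n
    induction n using Nat.strong_induction_on with
    | _ n ih =>
      have h1 := (h.2 n).sub (taylor_isLittleO_zero hf n)
      have h2 : (fun x : ℝ => iteratedDeriv n f 0 / n.factorial * x ^ n) =o[𝓝 0]
          fun x : ℝ => x ^ n := by
        refine h1.congr_left fun x => ?_
        rw [Finset.sum_range_succ, Finset.sum_eq_zero fun k hk => by
          rw [ih k (Finset.mem_range.1 hk)]; simp]
        ring
      by_contra hne
      have hc : iteratedDeriv n f 0 / n.factorial ≠ 0 :=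
        div_ne_zero hne (by exact_mod_cast n.factorial_ne_zero)
      have h3 : (fun x : ℝ => x ^ n) =o[𝓝 0] fun x : ℝ => x ^ n :=
        (isLittleO_const_mul_left_iff hc).1 h2
      have h4 := h3.def (c := 1 / 2) (by norm_num)
      have h5 : ∀ᶠ x : ℝ in 𝓝[≠] 0, False := by
        filter_upwards [nhdsWithin_le_nhds h4, self_mem_nhdsWithin] with x hx hx0
        have : 0 < ‖x ^ n‖ := norm_pos_iff.2 (pow_ne_zero n hx0)
        linarith
      simp only [eventually_false_iff_eq_bot] at h5
      exact NeBot.ne inferInstance h5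
  · intro h
    refine ⟨hf, fun n => (taylor_isLittleO_zero hf n).congr_left fun x => ?_⟩
    simp [h]

theorem IsFlat.deriv {f : ℝ → ℝ} (hf : IsFlat f) : IsFlat (deriv f) := by
  have h1 : ContDiff ℝ ∞ (_root_.deriv f) := (contDiff_infty_iff_deriv.1 hf.1).2
  rw [isFlat_iff_iteratedDeriv h1]
  intro n
  rw [← iteratedDeriv_succ']
  exact (isFlat_iff_iteratedDeriv hf.1).1 hf _

theorem IsFlat.zero {f : ℝ → ℝ} (hf : IsFlat f) : f 0 = 0 := by
  simpa using (isFlat_iff_iteratedDeriv hf.1).1 hf 0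

theorem IsFlat.hasDerivAt {f : ℝ → ℝ} (hf : IsFlat f) (x : ℝ) :
    HasDerivAt f (_root_.deriv f x) x :=
  (hf.1.differentiable (by simp) x).hasDerivAt

theorem IsFlat.div_pow_isLittleO {f : ℝ → ℝ} (hf : IsFlat f) (m n : ℕ) :
    (fun x => f x / x ^ m) =o[𝓝 0] fun x : ℝ => x ^ n := by
  refine IsLittleO.of_bound fun c hc => ?_
  filter_upwards [(hf.2 (n + m)).def hc] with x hx
  by_cases h : x = 0
  · subst h
    simp only [hf.zero, zero_div, norm_zero]
    positivity
  · rw [norm_div, div_le_iff₀ (norm_pos_iff.2 (pow_ne_zero m h)), mul_assoc, ← norm_mul, ← pow_add]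
    exact hx

/-- Division by zero returns `0`, which is the right value of the quotient at the origin. The
derivative is again a combination of flat functions divided by powers, so a single induction gives
smoothness of all such quotients. -/
theorem IsFlat.hasDerivAt_div_pow {f : ℝ → ℝ} (hf : IsFlat f) (m : ℕ) (x : ℝ) :
    HasDerivAt (fun x => f x / x ^ m)
      (_root_.deriv f x / x ^ m - m * (f x / x ^ (m + 1))) x := by
  by_cases h : x = 0
  · subst h
    have : _root_.deriv f 0 / 0 ^ m - m * (f 0 / 0 ^ (m + 1)) = 0 := by
      simp [hf.zero, hf.deriv.zero]
    rw [this, hasDerivAt_iff_isLittleO]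
    simpa [hf.zero] using hf.div_pow_isLittleO m 1
  · convert! (hf.hasDerivAt x).div (hasDerivAt_pow m x) (pow_ne_zero m h) using 1
    rcases m with _ | m
    · simp
    · have : x ^ m ≠ 0 := pow_ne_zero m h
      field_simp
      simp only [Nat.add_sub_cancel]
      ring

theorem IsFlat.div_pow {f : ℝ → ℝ} (hf : IsFlat f) (m : ℕ) : IsFlat fun x => f x / x ^ m := by
  refine ⟨contDiff_infty.2 fun n => ?_, hf.div_pow_isLittleO m⟩
  induction n generalizing f m with
  | zero =>
    exact contDiff_zero.2 <| continuous_iff_continuousAt.2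
      fun x => (hf.hasDerivAt_div_pow m x).continuousAt
  | succ n ih =>
    push_cast
    rw [contDiff_succ_iff_deriv]
    refine ⟨fun x => (hf.hasDerivAt_div_pow m x).differentiableAt, by simp, ?_⟩
    rw [funext fun x => (hf.hasDerivAt_div_pow m x).deriv]
    exact (ih hf.deriv m).sub (contDiff_const.mul (ih hf (m + 1)))

theorem IsFlat.const_mul {f : ℝ → ℝ} (hf : IsFlat f) (c : ℝ) : IsFlat fun x => c * f x :=
  ⟨contDiff_const.mul hf.1, fun n => (hf.2 n).const_mul_left c⟩

theorem IsFlat.add {f g : ℝ → ℝ} (hf : IsFlat f) (hg : IsFlat g) : IsFlat fun x => f x + g x :=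
  ⟨hf.1.add hg.1, fun n => (hf.2 n).add (hg.2 n)⟩

theorem IsFlat.comp_neg {f : ℝ → ℝ} (hf : IsFlat f) : IsFlat fun x => f (-x) := by
  refine ⟨hf.1.comp contDiff_neg, fun n => ?_⟩
  have h : Tendsto (fun x : ℝ => -x) (𝓝 0) (𝓝 0) := by
    simpa using (continuous_neg (G := ℝ)).tendsto 0
  refine ((hf.2 n).comp_tendsto h).trans_isBigO ?_
  refine IsBigO.of_bound 1 (Eventually.of_forall fun x => ?_)
  simp

/-- Since `√` is `0` on the negative axis, the composite is constantly `f 0 = 0` there; at the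
origin `f y = o(y ^ 2)` gives `f √x = o(x)`. The exponent `1` puts the derivative in the form
covered by `IsFlat.div_pow`, ready for induction. -/
theorem IsFlat.hasDerivAt_comp_sqrt {f : ℝ → ℝ} (hf : IsFlat f) (x : ℝ) :
    HasDerivAt (fun x => f √x) (1 / 2 * (_root_.deriv f √x / √x ^ 1)) x := by
  rcases lt_trichotomy x 0 with h | h | h
  · rw [Real.sqrt_eq_zero_of_nonpos h.le]
    have h1 : (fun x => f √x) =ᶠ[𝓝 x] fun _ => 0 := by
      filter_upwards [gt_mem_nhds h] with y hy
      rw [Real.sqrt_eq_zero_of_nonpos hy.le, hf.zero]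
    simpa using (hasDerivAt_const x (0 : ℝ)).congr_of_eventuallyEq h1
  · subst h
    have h0 : Tendsto (fun x : ℝ => √x) (𝓝 0) (𝓝 0) := by
      simpa using Real.continuous_sqrt.tendsto 0
    rw [hasDerivAt_iff_isLittleO]
    simp only [Real.sqrt_zero, hf.zero, sub_zero, smul_eq_mul]
    simp only [pow_one, div_zero, mul_zero, sub_zero]
    refine ((hf.2 2).comp_tendsto h0).trans_isBigO ?_
    refine IsBigO.of_bound 1 (Eventually.of_forall fun x => ?_)
    rcases le_total 0 x with hx | hx
    · simp [Real.sq_sqrt hx]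
    · simp [Real.sqrt_eq_zero_of_nonpos hx]
  · convert! (hf.hasDerivAt √x).comp x (Real.hasDerivAt_sqrt h.ne') using 1
    field_simp

theorem IsFlat.contDiff_comp_sqrt {f : ℝ → ℝ} (hf : IsFlat f) : ContDiff ℝ ∞ fun x => f √x := by
  refine contDiff_infty.2 fun n => ?_
  induction n generalizing f with
  | zero =>
    exact contDiff_zero.2 (hf.1.continuous.comp Real.continuous_sqrt)
  | succ n ih =>
    push_cast
    rw [contDiff_succ_iff_deriv]
    refine ⟨fun x => (hf.hasDerivAt_comp_sqrt x).differentiableAt, by simp, ?_⟩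
    rw [funext fun x => (hf.hasDerivAt_comp_sqrt x).deriv]
    exact contDiff_const.mul (ih (hf.deriv.div_pow 1))

/-- Borel's lemma: every sequence of reals is the sequence of derivatives at the origin of a
smooth function. -/
theorem exists_contDiff_iteratedDeriv_eq (c : ℕ → ℝ) :
    ∃ B : ℝ → ℝ, ContDiff ℝ ∞ B ∧ ∀ n, iteratedDeriv n B 0 = c n * n.factorial := by
  let χ : ContDiffBump (0 : ℝ) := ⟨1, 2, one_pos, one_lt_two⟩
  let φ : ℕ → ℝ → ℝ := fun n x => x ^ n * χ x
  have hφ : ∀ n, ContDiff ℝ ∞ (φ n) := fun n => (contDiff_id.pow n).mul χ.contDiff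
  have hM : ∀ n k, ∃ M, ∀ x, ‖iteratedDeriv k (φ n) x‖ ≤ M := by
    intro n k
    have h1 : HasCompactSupport (φ n) := χ.hasCompactSupport.mul_left
    have h2 : HasCompactSupport (iteratedFDeriv ℝ k (φ n)) := h1.iteratedFDeriv k
    obtain ⟨M, hM⟩ := ((hφ n).continuous_iteratedFDeriv
      (m := k) (by exact_mod_cast le_top)).bounded_above_of_compact_support h2
    exact ⟨M, fun x => by simpa only [norm_iteratedFDeriv_eq_norm_iteratedDeriv] using hM x⟩
  choose M hM using hM
  have hM0 : ∀ n k, 0 ≤ M n k := fun n k => (norm_nonneg _).trans (hM n k 0)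
  -- The `n`-th term is dilated by `l n`, so its `k`-th derivative scales as `l n ^ k / l n ^ n`.
  -- Since `l n` is at least `1` and at least `2 ^ n * |c n| * M n k` for all `k < n`, this
  -- derivative is at most `2 ^ (-n)` for `k < n`; the finitely many `n ≤ k` do not affect
  -- summability.
  let l : ℕ → ℝ := fun n => 2 ^ n * |c n| * (∑ k ∈ Finset.range n, M n k) + 1
  have hl : ∀ n, 1 ≤ l n := fun n => by
    have : 0 ≤ 2 ^ n * |c n| * (∑ k ∈ Finset.range n, M n k) :=
      mul_nonneg (by positivity) (Finset.sum_nonneg fun k _ => hM0 n k)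
    simp only [l]; linarith
  have hl0 : ∀ n, 0 < l n := fun n => one_pos.trans_le (hl n)
  let f : ℕ → ℝ → ℝ := fun n x => (c n * (l n ^ n)⁻¹) * φ n (l n * x)
  have hfs : ∀ n, ContDiff ℝ ∞ (f n) := fun n =>
    contDiff_const.mul ((hφ n).comp (contDiff_const.mul contDiff_id))
  have hfd : ∀ n k x, iteratedDeriv k (f n) x =
      (c n * (l n ^ n)⁻¹) * (l n ^ k * iteratedDeriv k (φ n) (l n * x)) := by
    intro n k x
    have h1 := iteratedDeriv_comp_const_mul (n := k)
      ((hφ n).of_le (by exact_mod_cast le_top)) (l n)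
    simp only [f]
    rw [iteratedDeriv_const_mul_field, h1]
  let v : ℕ → ℕ → ℝ := fun k n =>
    if k < n then (1 / 2) ^ n else |c n| * (l n ^ n)⁻¹ * (l n ^ k * M n k)
  have hv : ∀ k, Summable (v k) := by
    intro k
    refine (summable_geometric_two).congr_cofinite ?_
    refine (Set.finite_Iic k).subset fun n hn => ?_
    by_contra h
    exact hn (by simp [v, not_le.1 (fun h' => h (Set.mem_Iic.2 h'))])
  have hbound : ∀ (k n : ℕ) (x : ℝ), ‖iteratedFDeriv ℝ k (f n) x‖ ≤ v k n := by
    intro k n x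
    rw [norm_iteratedFDeriv_eq_norm_iteratedDeriv, hfd]
    have h1 : ‖(c n * (l n ^ n)⁻¹) * (l n ^ k * iteratedDeriv k (φ n) (l n * x))‖ ≤
        |c n| * (l n ^ n)⁻¹ * (l n ^ k * M n k) := by
      rw [norm_mul, norm_mul, norm_mul, norm_inv, norm_pow, norm_pow, Real.norm_eq_abs (l n),
        abs_of_pos (hl0 n), Real.norm_eq_abs (c n)]
      have := hl0 n
      gcongr
      exact hM n k _
    by_cases hk : k < n
    · refine h1.trans ?_
      simp only [v, if_pos hk]
      have h2 : l n ^ k * l n ≤ l n ^ n := by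
        rw [← pow_succ]; exact pow_le_pow_right₀ (hl n) hk
      have h3 : 2 ^ n * |c n| * M n k ≤ l n := by
        have : M n k ≤ ∑ k ∈ Finset.range n, M n k :=
          Finset.single_le_sum (f := M n) (fun i _ => hM0 n i) (Finset.mem_range.2 hk)
        have h4 : 2 ^ n * |c n| * M n k ≤ 2 ^ n * |c n| * ∑ k ∈ Finset.range n, M n k := by
          gcongr
        simp only [l]; linarith
      have h5 : 0 < l n ^ n := pow_pos (hl0 n) n
      have h6 : 2 ^ n * |c n| * M n k * l n ^ k ≤ l n ^ n := by
        calc _ ≤ l n * l n ^ k := by have := (pow_pos (hl0 n) k).le; gcongr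
          _ ≤ _ := by rw [mul_comm]; exact h2
      rw [one_div, inv_pow]
      rw [show |c n| * (l n ^ n)⁻¹ * (l n ^ k * M n k) = (|c n| * M n k * l n ^ k) / l n ^ n by
        field_simp, div_le_iff₀ h5, ← div_eq_inv_mul, le_div_iff₀ (by positivity)]
      linarith
    · simpa only [v, if_neg hk] using h1
  refine ⟨fun x => ∑' n, f n x, ?_, fun k => ?_⟩
  · exact contDiff_tsum (N := ⊤) hfs (fun k _ => hv k) fun k n x _ => hbound k n x
  · have h0 : ∀ n, iteratedDeriv k (φ n) 0 = if n = k then (k.factorial : ℝ) else 0 := by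
      intro n
      have h1 : φ n =ᶠ[𝓝 0] fun x => x ^ n := by
        filter_upwards [χ.eventuallyEq_one] with x hx
        simp [φ, hx]
      rw [h1.iteratedDeriv_eq, iteratedDeriv_fun_pow_zero]
      rcases eq_or_ne n k with rfl | h
      · simp
      · simp [h, h.symm]
    have h1 : ∀ n, n ≠ k → iteratedFDeriv ℝ k (f n) 0 = 0 := by
      intro n hn
      rw [← norm_eq_zero, norm_iteratedFDeriv_eq_norm_iteratedDeriv, hfd, mul_zero, h0, if_neg hn]
      simp
    have h2 : iteratedFDeriv ℝ k (fun x => ∑' n, f n x) 0 = iteratedFDeriv ℝ k (f k) 0 := by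
      rw [iteratedFDeriv_tsum_apply (N := ⊤) hfs (fun k _ => hv k)
        (fun k n x _ => hbound k n x) (by exact_mod_cast le_top), tsum_eq_single k h1]
    rw [iteratedDeriv_eq_iteratedFDeriv, h2, ← iteratedDeriv_eq_iteratedFDeriv, hfd, mul_zero, h0,
      if_pos rfl]
    have := pow_ne_zero k (hl0 k).ne'
    field_simp

/-- Hadamard's lemma in one variable. -/
theorem exists_contDiff_eq_mul {f : ℝ → ℝ} (hf : ContDiff ℝ ∞ f) (h0 : f 0 = 0) :
    ∃ g : ℝ → ℝ, ContDiff ℝ ∞ g ∧ ∀ x, f x = x * g x := by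
  -- `B` receives the Taylor series of `f x / x`, so `f x - x * B x` is flat and may be divided by
  -- `x`.
  obtain ⟨B, hB, hBc⟩ := exists_contDiff_iteratedDeriv_eq
    fun n => iteratedDeriv (n + 1) f 0 / (n + 1).factorial
  have hr : IsFlat fun x => f x - x * B x := by
    refine ⟨hf.sub (contDiff_id.mul hB), fun n => ?_⟩
    have h1 := (taylor_isLittleO_zero hf (n + 1)).trans
      ((isLittleO_pow_pow (𝕜 := ℝ) n.lt_succ_self))
    have h2 := (isBigO_refl (fun x : ℝ => x) (𝓝 0)).mul_isLittleO (taylor_isLittleO_zero hB n)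
    have h3 : (fun x : ℝ => x * x ^ n) =O[𝓝 0] fun x : ℝ => x ^ n := by
      simpa [pow_succ'] using (isLittleO_pow_pow (𝕜 := ℝ) n.lt_succ_self).isBigO
    refine (h1.sub (h2.trans_isBigO h3)).congr_left fun x => ?_
    rw [Finset.sum_range_succ' _ (n + 1), mul_sub, Finset.mul_sum]
    have : ∀ k ∈ Finset.range (n + 1), x * (iteratedDeriv k B 0 / k.factorial * x ^ k) =
        iteratedDeriv (k + 1) f 0 / (k + 1).factorial * x ^ (k + 1) := by
      intro k _
      have hk : (k.factorial : ℝ) ≠ 0 := by exact_mod_cast k.factorial_ne_zero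
      rw [hBc, mul_div_assoc, div_self hk]
      ring
    rw [Finset.sum_congr rfl this]
    simp [h0]
  refine ⟨fun x => B x + (f x - x * B x) / x ^ 1, hB.add (hr.div_pow 1).1, fun x => ?_⟩
  by_cases h : x = 0
  · simp [h, h0]
  · field_simp
    ring

/-- A smooth function of one variable is `a(x²) + x b(x²)` with `a` and `b` smooth (Whitney). -/
theorem exists_contDiff_even_odd {f : ℝ → ℝ} (hf : ContDiff ℝ ∞ f) :
    ∃ a b : ℝ → ℝ, ContDiff ℝ ∞ a ∧ ContDiff ℝ ∞ b ∧ ∀ x, f x = a (x ^ 2) + x * b (x ^ 2) := by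
  -- `A` and `B` take the even and the odd Taylor coefficients of `f`, which leaves a flat
  -- remainder.
  obtain ⟨A, hA, hAc⟩ := exists_contDiff_iteratedDeriv_eq
    fun n => iteratedDeriv (2 * n) f 0 / (2 * n).factorial
  obtain ⟨B, hB, hBc⟩ := exists_contDiff_iteratedDeriv_eq
    fun n => iteratedDeriv (2 * n + 1) f 0 / (2 * n + 1).factorial
  have hsq : Tendsto (fun x : ℝ => x ^ 2) (𝓝 0) (𝓝 0) := by
    simpa using (continuous_pow (M := ℝ) 2).tendsto 0
  have hpow : ∀ {m n : ℕ}, n ≤ m → (fun x : ℝ => x ^ m) =O[𝓝 0] fun x : ℝ => x ^ n := by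
    intro m n h
    rcases h.eq_or_lt with rfl | h
    · exact isBigO_refl _ _
    · exact (isLittleO_pow_pow (𝕜 := ℝ) h).isBigO
  have hr : IsFlat fun x => f x - A (x ^ 2) - x * B (x ^ 2) := by
    refine ⟨(hf.sub (hA.comp (contDiff_id.pow 2))).sub
      (contDiff_id.mul (hB.comp (contDiff_id.pow 2))), fun n => ?_⟩
    have h1 := (taylor_isLittleO_zero hf (2 * n + 1)).trans_isBigO
      (hpow (show n ≤ 2 * n + 1 by omega))
    have h2 := ((taylor_isLittleO_zero hA n).comp_tendsto hsq)
    have h3 := (isBigO_refl (fun x : ℝ => x) (𝓝 0)).mul_isLittleO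
      ((taylor_isLittleO_zero hB n).comp_tendsto hsq)
    have h4 : ((fun x : ℝ => x ^ n) ∘ fun x : ℝ => x ^ 2) =O[𝓝 0] fun x : ℝ => x ^ n := by
      simpa [Function.comp_def, ← pow_mul] using hpow (show n ≤ 2 * n by omega)
    have h5 : (fun x : ℝ => x * ((fun x : ℝ => x ^ n) ∘ fun x : ℝ => x ^ 2) x) =O[𝓝 0]
        fun x : ℝ => x ^ n := by
      simpa [Function.comp_def, ← pow_mul, ← pow_succ'] using
        hpow (show n ≤ 2 * n + 1 by omega)
    refine ((h1.sub (h2.trans_isBigO h4)).sub (h3.trans_isBigO h5)).congr_left fun x => ?_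
    have hsum : ∀ N, ∑ k ∈ Finset.range (2 * N),
        iteratedDeriv k f 0 / k.factorial * x ^ k =
        (∑ k ∈ Finset.range N, iteratedDeriv k A 0 / k.factorial * (x ^ 2) ^ k) +
        x * ∑ k ∈ Finset.range N, iteratedDeriv k B 0 / k.factorial * (x ^ 2) ^ k := by
      intro N
      induction N with
      | zero => simp
      | succ N ih =>
        have hk : (N.factorial : ℝ) ≠ 0 := by exact_mod_cast N.factorial_ne_zero
        rw [show 2 * (N + 1) = 2 * N + 1 + 1 by ring, Finset.sum_range_succ,
          Finset.sum_range_succ, ih, Finset.sum_range_succ, Finset.sum_range_succ, hAc, hBc,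
          mul_div_assoc _ (N.factorial : ℝ), mul_div_assoc _ (N.factorial : ℝ), div_self hk]
        ring
    simp only [Function.comp_apply]
    rw [show 2 * n + 1 + 1 = 2 * (n + 1) by ring, hsum]
    ring
  set r : ℝ → ℝ := fun x => f x - A (x ^ 2) - x * B (x ^ 2) with hrdef
  -- The even part of the remainder, and its odd part divided by `x`, are even and flat, hence
  -- smooth functions of `x ^ 2` through `√(x ^ 2) = |x|`.
  have he : IsFlat fun x => 1 / 2 * (r x + r (-x)) := (hr.add hr.comp_neg).const_mul _
  have ho : IsFlat fun x => (1 / 2 * (r x + -1 * r (-x))) / x ^ 1 :=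
    ((hr.add (hr.comp_neg.const_mul (-1))).const_mul _).div_pow 1
  refine ⟨_, _, hA.add he.contDiff_comp_sqrt, hB.add ho.contDiff_comp_sqrt, fun x => ?_⟩
  have hx : f x = r x + A (x ^ 2) + x * B (x ^ 2) := by simp only [hrdef]; ring
  rw [hx]
  simp only [Real.sqrt_sq_eq_abs]
  rcases lt_trichotomy x 0 with h | h | h
  · rw [abs_of_neg h]
    have := h.ne
    rw [neg_neg]
    field_simp
    ring
  · simp [h, hr.zero]
  · rw [abs_of_pos h]
    field_simp
    ring

/-! ### Reparametrization of a planar curve at an ordinary cusp -/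

/-- A function that is smooth near a point has a globally smooth representative of its germ. -/
theorem ContDiffOn.exists_contDiff_eventuallyEq {f : ℝ → ℝ} {s : Set ℝ} (hf : ContDiffOn ℝ ∞ f s)
    (hs : IsOpen s) {x : ℝ} (hx : x ∈ s) :
    ∃ g : ℝ → ℝ, ContDiff ℝ ∞ g ∧ g =ᶠ[𝓝 x] f := by
  obtain ⟨r, hr, hrs⟩ := Metric.isOpen_iff.1 hs x hx
  let χ : ContDiffBump x := ⟨r / 4, r / 2, by positivity, by linarith⟩
  refine ⟨fun y => χ y * f y, contDiff_iff_contDiffAt.2 fun y => ?_, ?_⟩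
  · by_cases hy : y ∈ s
    · exact χ.contDiff.contDiffAt.mul (hf.contDiffAt (hs.mem_nhds hy))
    · have hy' : y ∉ tsupport χ := fun h => hy (hrs (by
        rw [χ.tsupport_eq] at h
        exact Metric.closedBall_subset_ball (by simp only [χ]; linarith) h))
      have : (fun y => χ y * f y) =ᶠ[𝓝 y] fun _ => 0 := by
        filter_upwards [(notMem_tsupport_iff_eventuallyEq.1 hy')] with z hz
        simp [hz]
      exact contDiffAt_const.congr_of_eventuallyEq this
  · filter_upwards [χ.eventuallyEq_one] with y hy
    simp [hy]

/-- A smooth function on the line with a nondegenerate minimum at the origin is locally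
a square (one-dimensional Morse lemma). -/
theorem exists_sq_eq_of_deriv_deriv_pos {v : ℝ → ℝ} (hv : ContDiff ℝ ∞ v) (h0 : v 0 = 0)
    (h1 : deriv v 0 = 0) (h2 : 0 < deriv (deriv v) 0) :
    ∃ w : ℝ → ℝ, ContDiff ℝ ∞ w ∧ 0 < w 0 ∧ ∀ s, v s = s ^ 2 * w s := by
  obtain ⟨v1, hv1, hv1e⟩ := exists_contDiff_eq_mul hv h0
  have hd : ∀ {f : ℝ → ℝ}, ContDiff ℝ ∞ f → ∀ x, HasDerivAt f (deriv f x) x :=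
    fun hf x => (hf.differentiable (by simp) x).hasDerivAt
  have e1 : deriv v = fun s => v1 s + s * deriv v1 s := by
    funext s
    rw [funext hv1e]
    simpa using ((hasDerivAt_id' s).fun_mul (hd hv1 s)).deriv
  have hv10 : v1 0 = 0 := by simpa [e1] using h1
  obtain ⟨w, hw, hwe⟩ := exists_contDiff_eq_mul hv1 hv10
  have hv1' : deriv v1 0 = w 0 := by
    have := ((hasDerivAt_id' (0 : ℝ)).fun_mul (hd hw 0)).deriv
    rw [funext hwe]
    simpa using this
  refine ⟨w, hw, ?_, fun s => by rw [hv1e, hwe]; ring⟩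
  have e2 : deriv (deriv v) 0 = deriv v1 0 + deriv v1 0 := by
    rw [e1]
    have := ((hd hv1 0).fun_add ((hasDerivAt_id' (0 : ℝ)).fun_mul
      (hd (contDiff_infty_iff_deriv.1 hv1).2 0))).deriv
    simpa using this
  rw [e2, hv1'] at h2
  linarith

/-- Normal form of a planar curve `(u, v)` at a point where `v` has a nondegenerate minimum and the
slope `m = u' / v'` has nonvanishing derivative. -/
theorem exists_cusp_parameter {u v m : ℝ → ℝ} {N : Set ℝ} (hN : IsOpen N) (h0N : (0 : ℝ) ∈ N)
    (hu : ContDiffOn ℝ ∞ u N) (hv : ContDiffOn ℝ ∞ v N) (hv0 : v 0 = 0) (hv1 : deriv v 0 = 0)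
    (hv2 : 0 < deriv (deriv v) 0) (hm : ∀ᶠ s in 𝓝 0, deriv u s = m s * deriv v s) {m' : ℝ}
    (hm' : HasDerivAt m m' 0) (hm0 : m' ≠ 0) :
    ∃ (a b τ : ℝ → ℝ) (τ' : ℝ), ContDiff ℝ ∞ a ∧ ContDiff ℝ ∞ b ∧ b 0 ≠ 0 ∧ τ 0 = 0 ∧
      HasStrictDerivAt τ τ' 0 ∧ τ' ≠ 0 ∧
      ∀ᶠ s in 𝓝 0, v s = τ s ^ 2 ∧ u s = a (τ s ^ 2) + τ s ^ 3 * b (τ s ^ 2) := by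
  have hd : ∀ {f : ℝ → ℝ}, ContDiff ℝ ∞ f → ∀ x, HasDerivAt f (deriv f x) x :=
    fun hf x => (hf.differentiable (by simp) x).hasDerivAt
  obtain ⟨v₁, hv₁, hvv⟩ := hv.exists_contDiff_eventuallyEq hN h0N
  obtain ⟨w, hw, hw0, hwe⟩ := exists_sq_eq_of_deriv_deriv_pos hv₁ (by rw [hvv.eq_of_nhds, hv0])
    (by rw [hvv.deriv_eq, hv1]) (by rwa [hvv.deriv.deriv_eq])
  -- A smooth square root of `v`, with nonzero derivative `√(w 0)` at the origin; it is the new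
  -- parameter.
  let τ : ℝ → ℝ := fun s => s * √(w s)
  have hτs : ∀ s, 0 < w s → ContDiffAt ℝ ∞ τ s := fun s hs =>
    contDiffAt_id.mul (hw.contDiffAt.sqrt hs.ne')
  have hτd : HasDerivAt τ (√(w 0)) 0 := by
    simpa using (hasDerivAt_id' (0 : ℝ)).fun_mul ((hd hw 0).sqrt hw0.ne')
  have hτ0 : τ 0 = 0 := by simp [τ]
  have hτ' : √(w 0) ≠ 0 := (Real.sqrt_pos.2 hw0).ne'
  have hτst : HasStrictDerivAt τ (√(w 0)) 0 := by
    have := (hτs 0 hw0).hasStrictDerivAt (by simp)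
    rwa [hτd.deriv] at this
  have hwpos : ∀ᶠ s in 𝓝 0, 0 < w s := hw.continuous.continuousAt.eventually (lt_mem_nhds hw0)
  have hτ'ne : ∀ᶠ s in 𝓝 0, deriv τ s ≠ 0 := by
    have h1 : ContDiffAt ℝ 0 (deriv τ) 0 := ((hτs 0 hw0).of_le (m := 1) (by simp)).derivWithin (by simp)
    have h2 := h1.continuousAt
    exact h2.eventually_ne (by rwa [hτd.deriv])
  let T := (hτst.hasStrictFDerivAt_equiv hτ').toOpenPartialHomeomorph τ
  have hT : ∀ s, T s = τ s := fun s => rfl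
  have h0T : (0 : ℝ) ∈ T.source :=
    (hτst.hasStrictFDerivAt_equiv hτ').mem_toOpenPartialHomeomorph_source
  obtain ⟨O, hO, hOo, h0O⟩ := eventually_nhds_iff.1
    ((hwpos.and hτ'ne).and (hN.mem_nhds h0N))
  have hS : IsOpen (T.target ∩ T.symm ⁻¹' O) := T.isOpen_inter_preimage_symm hOo
  have hT0 : T 0 = 0 := hτ0
  have h0S : (0 : ℝ) ∈ T.target ∩ T.symm ⁻¹' O := by
    refine ⟨hT0 ▸ T.map_source h0T, ?_⟩
    have : T.symm 0 = 0 := by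
      conv_lhs => rw [← hT0]
      exact T.left_inv h0T
    simpa [this] using h0O
  have hUs : ContDiffOn ℝ ∞ (u ∘ T.symm) (T.target ∩ T.symm ⁻¹' O) := by
    intro y hy
    obtain ⟨⟨hy1, hy2⟩, hy3⟩ := hO _ hy.2
    refine ContDiffAt.contDiffWithinAt (ContDiffAt.comp y (hu.contDiffAt (hN.mem_nhds hy3)) ?_)
    exact T.contDiffAt_symm_deriv hy2 hy.1
      ((hτs _ hy1).differentiableAt (by simp)).hasDerivAt (hτs _ hy1)
  obtain ⟨U, hU, hUe⟩ := hUs.exists_contDiff_eventuallyEq hS h0S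
  have hτc : Tendsto τ (𝓝 0) (𝓝 0) := by simpa [hτ0] using hτd.continuousAt.tendsto
  have hUu : ∀ᶠ s in 𝓝 0, u s = U (τ s) := by
    filter_upwards [hτc.eventually hUe, T.open_source.mem_nhds h0T] with s hs hs'
    rw [hs, ← hT, Function.comp_apply, T.left_inv hs']
  have hvτ : ∀ᶠ s in 𝓝 0, v s = τ s ^ 2 := by
    filter_upwards [hvv, hwpos] with s hs hs'
    rw [← hs, hwe, mul_pow, Real.sq_sqrt hs'.le]
  -- the slope in terms of the new parameter
  have hslope : ∀ᶠ s in 𝓝 0, deriv U (τ s) = 2 * τ s * m s := by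
    filter_upwards [hUu.eventually_nhds, hvτ.eventually_nhds, hm, hwpos, hτ'ne]
      with s h1 h2 h3 h4 h5
    have hτs' := ((hτs s h4).differentiableAt (by simp)).hasDerivAt
    have e1 : deriv u s = deriv U (τ s) * deriv τ s := by
      rw [EventuallyEq.deriv_eq h1]
      exact ((hd hU (τ s)).comp s hτs').deriv
    have e2 : deriv v s = 2 * τ s * deriv τ s := by
      rw [EventuallyEq.deriv_eq h2]
      simpa using (hτs'.fun_pow 2).deriv
    rw [e1, e2] at h3
    apply mul_right_cancel₀ h5
    linear_combination h3
  have hU0 : deriv U 0 = 0 := by simpa [hτ0] using hslope.self_of_nhds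
  obtain ⟨a, B, ha, hB, hUab⟩ := exists_contDiff_even_odd hU
  have hsq : ∀ x : ℝ, HasDerivAt (fun x => x ^ 2) (2 * x) x := fun x => by
    simpa using hasDerivAt_pow 2 x
  have hcomp : ∀ {f : ℝ → ℝ}, ContDiff ℝ ∞ f → ∀ x,
      HasDerivAt (fun x => f (x ^ 2)) (deriv f (x ^ 2) * (2 * x)) x :=
    fun hf x => (hd hf (x ^ 2)).comp x (hsq x)
  -- The derivative of `U` at the origin is `B 0`, so its vanishing lets another factor `t ^ 2` be
  -- extracted from the odd part.
  have hB0 : B 0 = 0 := by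
    have := ((hcomp ha 0).fun_add ((hasDerivAt_id' (0 : ℝ)).fun_mul (hcomp hB 0))).deriv
    rw [← funext hUab, hU0] at this
    simpa using this.symm
  obtain ⟨b, hb, hBb⟩ := exists_contDiff_eq_mul hB hB0
  have hU' : ∀ t, U t = a (t ^ 2) + t ^ 3 * b (t ^ 2) := fun t => by rw [hUab, hBb]; ring
  refine ⟨a, b, τ, √(w 0), ha, hb, fun hb0 => hm0 ?_, hτ0, hτst, hτ', ?_⟩
  -- `G` is `U' / (2 t)`, so `m = G ∘ τ`, first off the origin and then at it by continuity. Since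
  -- `G' 0 = 3 / 2 * b 0`, the assumption `b 0 = 0` would give `m` derivative zero.
  · let G : ℝ → ℝ := fun t => deriv a (t ^ 2) + 3 / 2 * t * b (t ^ 2) + t ^ 3 * deriv b (t ^ 2)
    have ha' := (contDiff_infty_iff_deriv.1 ha).2
    have hb' := (contDiff_infty_iff_deriv.1 hb).2
    have hG : HasDerivAt G 0 0 := by
      have := ((hcomp ha' 0).fun_add (((hasDerivAt_id' (0 : ℝ)).const_mul (3 / 2)).fun_mul
        (hcomp hb 0))).fun_add ((hasDerivAt_pow 3 (0 : ℝ)).fun_mul (hcomp hb' 0))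
      simpa [hb0] using this
    have hG' : HasDerivAt (fun s => G (τ s)) 0 0 := by
      have : HasDerivAt G 0 (τ 0) := by rwa [hτ0]
      simpa [Function.comp_def] using this.comp (0 : ℝ) hτd
    have hUd : ∀ t, deriv U t = 2 * t * G t := by
      intro t
      have := ((hcomp ha t).fun_add ((hasDerivAt_pow 3 t).fun_mul (hcomp hb t))).deriv
      rw [← funext hU'] at this
      rw [this]
      simp only [G]
      push_cast
      ring
    have hne : ∀ᶠ s in 𝓝[≠] 0, m s = G (τ s) := by
      have hτne : ∀ᶠ s in 𝓝[≠] 0, τ s ≠ 0 := hτd.eventually_ne hτ'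
      filter_upwards [hslope.filter_mono nhdsWithin_le_nhds, hτne] with s h1 h2
      rw [hUd] at h1
      have : 2 * τ s ≠ 0 := mul_ne_zero two_ne_zero h2
      exact (mul_left_cancel₀ this h1).symm
    have heq : m =ᶠ[𝓝 0] fun s => G (τ s) :=
      (hm'.continuousAt.eventuallyEq_nhds_iff_eventuallyEq_nhdsNE hG'.continuousAt).1 hne
    exact hm'.unique (hG'.congr_of_eventuallyEq heq)
  · filter_upwards [hvτ, hUu] with s h1 h2
    exact ⟨h1, by rw [h2, hU']⟩

/-! ### Curves with a moving tangent direction, and the cusp criterion -/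

/-- The term with the second derivative of `f` carries the factor `D' s₀ = 0`. -/
theorem hasDerivAt_fderiv_apply_of_deriv_eq_zero {E F : Type*} [NormedAddCommGroup E]
    [NormedSpace ℝ E] [NormedAddCommGroup F] [NormedSpace ℝ F] {f : E → F} {D e : ℝ → E}
    {e' : E} {s₀ : ℝ} (hf : ContDiffAt ℝ 2 f (D s₀)) (hD : HasDerivAt D 0 s₀)
    (he : HasDerivAt e e' s₀) :
    HasDerivAt (fun s => fderiv ℝ f (D s) (e s)) (fderiv ℝ f (D s₀) e') s₀ := by
  have h1 : DifferentiableAt ℝ (fderiv ℝ f) (D s₀) :=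
    (hf.fderiv_right (m := 1) (by norm_num)).differentiableAt (by simp)
  have h2 : HasDerivAt (fun s => fderiv ℝ f (D s)) 0 s₀ := by
    simpa [Function.comp_def] using h1.hasFDerivAt.comp_hasDerivAt s₀ hD
  simpa using h2.clm_apply he

/-- At a singular point of a curve `D` with velocity `δ • e`, a map `ψ` with a left inverse along
the curve keeps `e` and `e'` linearly independent. -/
theorem linearIndependent_fderiv_direction {D e : ℝ → R31} {δ : ℝ → ℝ} {ψ : R31 → R2}
    {Φ : R2 → R31} {s₀ : ℝ} {e' : R31}
    (hD : ∀ᶠ s in 𝓝 s₀, HasDerivAt D (δ s • e s) s) (hδ : δ s₀ = 0)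
    (hfreq : ∃ᶠ s in 𝓝[≠] s₀, δ s ≠ 0) (hψ : ContDiffAt ℝ ∞ ψ (D s₀))
    (hΦ : ContDiffAt ℝ ∞ Φ (ψ (D s₀))) (heq : ∀ᶠ s in 𝓝 s₀, Φ (ψ (D s)) = D s)
    (he : HasDerivAt e e' s₀) (hli : LinearIndependent ℝ ![e s₀, e']) :
    LinearIndependent ℝ ![fderiv ℝ ψ (D s₀) (e s₀), fderiv ℝ ψ (D s₀) e'] := by
  have hD0 : HasDerivAt D 0 s₀ := by simpa [hδ] using hD.self_of_nhds
  have hψ2 : ContDiffAt ℝ 2 ψ (D s₀) := by exact_mod_cast contDiffAt_infty.1 hψ 2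
  have hΦ2 : ContDiffAt ℝ 2 Φ (ψ (D s₀)) := by exact_mod_cast contDiffAt_infty.1 hΦ 2
  have hψD : HasDerivAt (fun s => ψ (D s)) 0 s₀ := by
    simpa [Function.comp_def] using
      (hψ2.differentiableAt (by simp)).hasFDerivAt.comp_hasDerivAt s₀ hD0
  set g : ℝ → R2 := fun s => fderiv ℝ ψ (D s) (e s) with hg
  have hg' : HasDerivAt g (fderiv ℝ ψ (D s₀) e') s₀ :=
    hasDerivAt_fderiv_apply_of_deriv_eq_zero hψ2 hD0 he
  have hK : HasDerivAt (fun s => fderiv ℝ Φ (ψ (D s)) (g s))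
      (fderiv ℝ Φ (ψ (D s₀)) (fderiv ℝ ψ (D s₀) e')) s₀ :=
    hasDerivAt_fderiv_apply_of_deriv_eq_zero (D := fun s => ψ (D s)) hΦ2 hψD hg'
  have hdψ : ∀ᶠ s in 𝓝 s₀, DifferentiableAt ℝ ψ (D s) :=
    hD0.continuousAt.eventually ((hψ2.eventually (by simp)).mono
      fun x hx => hx.differentiableAt (by simp))
  have hdΦ : ∀ᶠ s in 𝓝 s₀, DifferentiableAt ℝ Φ (ψ (D s)) :=
    hψD.continuousAt.eventually ((hΦ2.eventually (by simp)).mono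
      fun x hx => hx.differentiableAt (by simp))
  -- Where `δ ≠ 0`, differentiating `Φ ∘ ψ ∘ D = D` shows that the composite differential fixes `e`.
  -- A differentiable function whose zeros accumulate at `s₀` vanishes there together with its
  -- derivative, so at `s₀` the composite differential fixes both `e` and `e'`.
  have hsub := hK.fun_sub he
  have hzero : ∃ᶠ s in 𝓝[≠] s₀, fderiv ℝ Φ (ψ (D s)) (g s) - e s = 0 := by
    refine (hfreq.and_eventually ((((hD.and hdψ).and hdΦ).and heq.eventually_nhds).filter_mono
      nhdsWithin_le_nhds)).mono ?_
    rintro s ⟨h1, ⟨⟨h2, h3⟩, h4⟩, h5⟩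
    have h6 := h4.hasFDerivAt.comp_hasDerivAt s (h3.hasFDerivAt.comp_hasDerivAt s h2)
    have h7 : HasDerivAt D (fderiv ℝ Φ (ψ (D s)) (fderiv ℝ ψ (D s) (δ s • e s))) s :=
      h6.congr_of_eventuallyEq (EventuallyEq.symm h5)
    have h8 := h7.unique h2
    rw [map_smul, map_smul] at h8
    rw [sub_eq_zero]
    exact smul_right_injective _ h1 h8
  have h0 : fderiv ℝ Φ (ψ (D s₀)) (g s₀) - e s₀ = 0 := by
    by_contra hne
    exact hzero ((hsub.continuousAt.eventually_ne hne).filter_mono nhdsWithin_le_nhds)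
  have h1 : fderiv ℝ Φ (ψ (D s₀)) (fderiv ℝ ψ (D s₀) e') - e' = 0 := by
    by_contra hne
    exact hzero (hsub.eventually_ne hne)
  rw [LinearIndependent.pair_iff] at hli ⊢
  intro x y hxy
  refine hli x y ?_
  have := congrArg (fderiv ℝ Φ (ψ (D s₀))) hxy
  rw [map_add, map_smul, map_smul, map_zero] at this
  rw [← this, sub_eq_zero.1 h1]
  congr 2
  exact (sub_eq_zero.1 h0).symm

theorem det_ne_zero_of_linearIndependent {a b : R2} (h : LinearIndependent ℝ ![a, b]) :
    a 0 * b 1 - a 1 * b 0 ≠ 0 := by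
  intro hd
  rw [LinearIndependent.pair_iff] at h
  have h1 := h (b 1) (-a 1) (by
    ext i; fin_cases i <;> simp <;> linarith)
  have h2 := h (b 0) (-a 0) (by
    ext i; fin_cases i <;> simp <;> linarith)
  have ha : a = 0 := by
    ext i; fin_cases i
    · simpa using h2.2
    · simpa using h1.2
  have := h 1 0 (by simp [ha])
  simp at this

/-! ### Necessity: a cusp image forces a simple zero -/

/-- A smooth curve in the cusp has vanishing velocity at the vertex. -/
theorem deriv_eq_zero_of_mem_cusp {u v : ℝ → ℝ} {s₀ : ℝ} (hu : ContDiffAt ℝ ∞ u s₀)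
    (hv : ContDiffAt ℝ ∞ v s₀) (huv : ∀ᶠ s in 𝓝 s₀, u s ^ 2 = v s ^ 3) (hv0 : v s₀ = 0) :
    deriv u s₀ = 0 ∧ deriv v s₀ = 0 := by
  have hvn : ∀ᶠ s in 𝓝 s₀, 0 ≤ v s := by
    filter_upwards [huv] with s hs
    by_contra h
    have : v s ^ 3 < 0 := by
      have := not_le.1 h
      exact Odd.pow_neg (by decide) this
    nlinarith [sq_nonneg (u s)]
  have h1 : deriv v s₀ = 0 := by
    refine IsLocalMin.deriv_eq_zero ?_
    filter_upwards [hvn] with s hs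
    rwa [hv0]
  refine ⟨?_, h1⟩
  have hu0 : u s₀ = 0 := by
    have := huv.self_of_nhds
    rw [hv0] at this
    simpa using this
  have hud := (hu.differentiableAt (by simp)).hasDerivAt
  have hvd := (hv.differentiableAt (by simp)).hasDerivAt
  have h2 := (hasDerivAt_iff_tendsto_slope.1 hud)
  have h3 := (hasDerivAt_iff_tendsto_slope.1 hvd)
  have h4 : Tendsto v (𝓝[≠] s₀) (𝓝 0) := by
    simpa [hv0] using hvd.continuousAt.tendsto.mono_left nhdsWithin_le_nhds
  -- Dividing `u ^ 2 = v ^ 3` by `(s - s₀) ^ 2` exhibits this product as the squared slope of `u`.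
  have h5 : Tendsto (fun s => slope v s₀ s ^ 2 * v s) (𝓝[≠] s₀) (𝓝 0) := by
    simpa using (h3.pow 2).mul h4
  have h6 : Tendsto (fun s => slope u s₀ s ^ 2) (𝓝[≠] s₀) (𝓝 0) := by
    refine h5.congr' ?_
    filter_upwards [huv.filter_mono nhdsWithin_le_nhds, self_mem_nhdsWithin] with s hs hs'
    have : s - s₀ ≠ 0 := sub_ne_zero.2 hs'
    simp only [slope_def_field, hv0, hu0, sub_zero]
    rw [div_pow, div_pow, hs]
    ring
  have h7 := tendsto_nhds_unique h6 (h2.pow 2)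
  exact pow_eq_zero_iff (two_ne_zero) |>.1 h7.symm

theorem exists_ne_zero_mem_cusp {W : Set R2} (hW : IsOpen W) (h0 : 0 ∈ W) :
    ∃ x ∈ cusp ∩ W, x ≠ 0 := by
  have hc : Continuous fun r : ℝ => (![r ^ 3, r ^ 2] : R2) := by
    refine continuous_pi fun i => ?_
    fin_cases i <;> simp <;> fun_prop
  have h1 : ∀ᶠ r : ℝ in 𝓝 0, (![r ^ 3, r ^ 2] : R2) ∈ W := by
    refine hc.continuousAt.eventually (hW.mem_nhds ?_)
    convert! h0
    ext i; fin_cases i <;> simp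
  obtain ⟨r, hr, hr0⟩ := ((h1.filter_mono nhdsWithin_le_nhds).and
    (self_mem_nhdsWithin : {0}ᶜ ∈ 𝓝[≠] (0 : ℝ))).exists
  refine ⟨_, ⟨?_, hr⟩, fun h => hr0 ?_⟩
  · simp only [cusp, Set.mem_ofPred_eq, Matrix.cons_val_zero, Matrix.cons_val_one]
    ring
  · simpa using congrFun h 1

/-- Otherwise `D` is constant near `s₀` and its image is a point, whereas the cusp has points other
than the vertex in every neighbourhood of it and `φ` is injective. -/
theorem frequently_ne_zero_of_imageLocallyCuspAt {Q : Set R31} {D e : ℝ → R31} {δ : ℝ → ℝ}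
    {s₀ : ℝ} (hD : ∀ᶠ s in 𝓝 s₀, HasDerivAt D (δ s • e s) s) (h0 : δ s₀ = 0)
    (hcusp : ImageLocallyCuspAt Q D s₀) : ∃ᶠ s in 𝓝[≠] s₀, δ s ≠ 0 := by
  intro hev
  have hev' : ∀ᶠ s in 𝓝 s₀, δ s = 0 := by
    rw [eventually_nhdsWithin_iff] at hev
    filter_upwards [hev] with s hs
    by_cases h : s = s₀
    · rw [h, h0]
    · exact not_not.1 (hs h)
  obtain ⟨r, hr, hball⟩ := Metric.eventually_nhds_iff_ball.1 (hD.and hev')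
  obtain ⟨ε, ⟨W, V, φ, ψ, hW, hV, h0W, hφ0, hφ, hψ, hφW, hψφ, hA⟩, hε0, hεr⟩ :=
    (hcusp.and (Ioo_mem_nhdsGT hr)).exists
  obtain ⟨x, hx, hx0⟩ := exists_ne_zero_mem_cusp hW h0W
  obtain ⟨⟨s, hs, hsx⟩, -⟩ : φ x ∈ D '' Set.Ioo (s₀ - ε) (s₀ + ε) ∩ V :=
    hA ▸ Set.mem_image_of_mem φ hx
  have hconst : D s = D s₀ := by
    rw [← Real.ball_eq_Ioo] at hs
    have hd : ∀ y ∈ Metric.ball s₀ ε, HasDerivAt D 0 y := fun y hy => by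
      have := hball y (Metric.ball_subset_ball hεr.le hy)
      simpa [this.2] using this.1
    exact Metric.isOpen_ball.is_const_of_deriv_eq_zero (convex_ball s₀ ε).isPreconnected
      (fun y hy => (hd y hy).differentiableAt.differentiableWithinAt)
      (fun y hy => (hd y hy).deriv) hs (Metric.mem_ball_self hε0)
  apply hx0
  rw [← hψφ x hx.2, ← hsx, hconst, ← hφ0, hψφ 0 h0W]

/-- A function whose derivative is `o(s - s₀)` is constant up to `o((s - s₀)²)`. -/
theorem tendsto_div_sq_of_hasDerivAt {v v' : ℝ → ℝ} {s₀ : ℝ}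
    (hv : ∀ᶠ s in 𝓝 s₀, HasDerivAt v (v' s) s) (hv0 : v s₀ = 0) (h0 : v' s₀ = 0)
    (h : HasDerivAt v' 0 s₀) : Tendsto (fun s => v s / (s - s₀) ^ 2) (𝓝[≠] s₀) (𝓝 0) := by
  rw [hasDerivAt_iff_isLittleO] at h
  simp only [h0, sub_zero, smul_zero] at h
  rw [Metric.tendsto_nhds]
  intro c hc
  obtain ⟨r, hr, hball⟩ := Metric.eventually_nhds_iff_ball.1 (hv.and (h.def (half_pos hc)))
  filter_upwards [nhdsWithin_le_nhds (Metric.ball_mem_nhds s₀ hr), self_mem_nhdsWithin]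
    with s hs hs0
  have hpos : 0 < |s - s₀| := abs_pos.2 (sub_ne_zero.2 hs0)
  have hsub : Metric.closedBall s₀ |s - s₀| ⊆ Metric.ball s₀ r :=
    Metric.closedBall_subset_ball (by simpa [Real.dist_eq] using hs)
  have key := (convex_closedBall s₀ |s - s₀|).norm_image_sub_le_of_norm_hasDerivWithin_le
    (f := v) (f' := v') (C := c / 2 * |s - s₀|) (x := s₀) (y := s)
    (fun y hy => (hball y (hsub hy)).1.hasDerivWithinAt)
    (fun y hy => (hball y (hsub hy)).2.trans (by
      have : ‖y - s₀‖ ≤ |s - s₀| := by simpa [Real.dist_eq] using hy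
      gcongr)) (Metric.mem_closedBall_self hpos.le) (by simp [Real.dist_eq])
  rw [hv0, sub_zero, Real.norm_eq_abs, Real.norm_eq_abs] at key
  rw [dist_zero_right, norm_div, Real.norm_eq_abs, Real.norm_eq_abs, abs_pow,
    div_lt_iff₀ (by positivity)]
  nlinarith [mul_pos hc (mul_pos hpos hpos)]

/-- If the image of a curve with velocity `δ • e`, with `e` and `e'` linearly independent, is an
ordinary cusp, then `δ` has a simple zero. -/
theorem simple_zero_of_imageLocallyCuspAt {Q : Set R31} {D e : ℝ → R31} {δ : ℝ → ℝ} {s₀ : ℝ}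
    {N : Set ℝ} (hN : IsOpen N) (hs₀ : s₀ ∈ N) (hDs : ContDiffOn ℝ ∞ D N)
    (he : ContDiffOn ℝ ∞ e N) (hδ : ContDiffOn ℝ ∞ δ N)
    (hD : ∀ s ∈ N, HasDerivAt D (δ s • e s) s)
    (hli : LinearIndependent ℝ ![e s₀, deriv e s₀]) (hcusp : ImageLocallyCuspAt Q D s₀) :
    δ s₀ = 0 ∧ deriv δ s₀ ≠ 0 := by
  have hNn : N ∈ 𝓝 s₀ := hN.mem_nhds hs₀
  obtain ⟨r, hr, hrN⟩ := Metric.isOpen_iff.1 hN s₀ hs₀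
  obtain ⟨ε, ⟨W, V, φ, ψ, hW, hV, h0W, hφ0, hφ, hψ, hφW, hψφ, hA⟩, hε0, hεr⟩ :=
    (hcusp.and (Ioo_mem_nhdsGT hr)).exists
  have he' : HasDerivAt e (deriv e s₀) s₀ :=
    ((he.contDiffAt hNn).differentiableAt (by simp)).hasDerivAt
  have hδ' : HasDerivAt δ (deriv δ s₀) s₀ :=
    ((hδ.contDiffAt hNn).differentiableAt (by simp)).hasDerivAt
  have hDev : ∀ᶠ s in 𝓝 s₀, HasDerivAt D (δ s • e s) s := by
    filter_upwards [hNn] with s hs using hD s hs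
  have hVn : V ∈ 𝓝 (D s₀) := hV.mem_nhds (hφ0 ▸ (hφW ▸ Set.mem_image_of_mem φ h0W : φ 0 ∈ Q ∩ V).2)
  have hψ0 : ψ (D s₀) = 0 := by rw [← hφ0, hψφ 0 h0W]
  have hDc : ContinuousAt D s₀ := (hD s₀ hs₀).continuousAt
  have hI : Set.Ioo (s₀ - ε) (s₀ + ε) ∈ 𝓝 s₀ := Ioo_mem_nhds (by linarith) (by linarith)
  have hmem : ∀ᶠ s in 𝓝 s₀, ∃ x ∈ cusp ∩ W, φ x = D s := by
    filter_upwards [hI, hDc.eventually hVn] with s h1 h2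
    have h3 : D s ∈ φ '' (cusp ∩ W) := hA ▸ ⟨Set.mem_image_of_mem D h1, h2⟩
    exact h3
  have heq : ∀ᶠ s in 𝓝 s₀, φ (ψ (D s)) = D s := by
    filter_upwards [hmem] with s hs
    obtain ⟨x, hx, hxs⟩ := hs
    rw [← hxs, hψφ x hx.2]
  have hψs : ContDiffAt ℝ ∞ ψ (D s₀) := hψ.contDiffAt hVn
  have hφs : ContDiffAt ℝ ∞ φ (ψ (D s₀)) := by
    rw [hψ0]; exact hφ.contDiffAt (hW.mem_nhds h0W)
  have hc : ∀ᶠ s in 𝓝 s₀, ψ (D s) 0 ^ 2 = ψ (D s) 1 ^ 3 := by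
    filter_upwards [hmem] with s hs
    obtain ⟨x, hx, hxs⟩ := hs
    rw [← hxs, hψφ x hx.2]
    exact hx.1
  set g : ℝ → R2 := fun s => fderiv ℝ ψ (D s) (e s) with hg
  have hds : ∀ᶠ s in 𝓝 s₀, ContDiffAt ℝ ∞ (fun s => ψ (D s)) s ∧
      HasDerivAt (fun s => ψ (D s)) (δ s • g s) s := by
    filter_upwards [hNn, hDc.eventually hVn] with s h1 h2
    have h3 := hψ.contDiffAt (hV.mem_nhds h2)
    refine ⟨h3.comp s (hDs.contDiffAt (hN.mem_nhds h1)), ?_⟩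
    have := (h3.differentiableAt (by simp)).hasFDerivAt.comp_hasDerivAt s (hD s h1)
    simpa [Function.comp_def] using this
  have hcomp : ∀ᶠ s in 𝓝 s₀, ∀ i, HasDerivAt (fun s => ψ (D s) i) (δ s * g s i) s := by
    filter_upwards [hds] with s hs i
    simpa using hasDerivAt_pi.1 hs.2 i
  -- Any nearby parameter at which the curve meets the vertex is a stopping point, not only `s₀`;
  -- this excludes `v = 0` wherever `δ ≠ 0`.
  have hvertex : ∀ᶠ s in 𝓝 s₀, ψ (D s) 1 = 0 → δ s • g s = 0 := by
    filter_upwards [hc.eventually_nhds, hds, hcomp] with s h1 h2 h3 h4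
    have h5 := deriv_eq_zero_of_mem_cusp (contDiffAt_pi.1 h2.1 0) (contDiffAt_pi.1 h2.1 1) h1 h4
    rw [(h3 0).deriv, (h3 1).deriv] at h5
    ext i; fin_cases i
    · simpa using h5.1
    · simpa using h5.2
  have hδ0 : δ s₀ = 0 := by
    have h1 := hvertex.self_of_nhds (by simp [hψ0])
    have h2 := (hφs.differentiableAt (by simp)).hasFDerivAt.comp_hasDerivAt s₀
      hds.self_of_nhds.2
    have h3 := (h2.congr_of_eventuallyEq (EventuallyEq.symm heq)).unique (hD s₀ hs₀)
    rw [h1, map_zero] at h3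
    exact (smul_eq_zero.1 h3.symm).resolve_right (hli.ne_zero 0)
  refine ⟨hδ0, fun hδ1 => ?_⟩
  have hfreq := frequently_ne_zero_of_imageLocallyCuspAt hDev hδ0 hcusp
  have hdet := det_ne_zero_of_linearIndependent
    (linearIndependent_fderiv_direction hDev hδ0 hfreq hψs hφs heq he' hli)
  have hg' : HasDerivAt g (fderiv ℝ ψ (D s₀) (deriv e s₀)) s₀ :=
    hasDerivAt_fderiv_apply_of_deriv_eq_zero (by exact_mod_cast contDiffAt_infty.1 hψs 2)
      (by simpa [hδ0] using hD s₀ hs₀) he'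
  have hg0 : g s₀ ≠ 0 := by
    intro h
    have h0 := congrFun h 0
    have h1 := congrFun h 1
    simp only [hg, Pi.zero_apply] at h0 h1
    rw [h0, h1] at hdet
    simp at hdet
  -- The derivative of `u ^ 2 = v ^ 3`, divided by `δ`, is `2 u g₀ = 3 v ^ 2 g₁`. Squaring,
  -- substituting `u ^ 2 = v ^ 3` and cancelling `v ^ 3` gives the relation.
  have hrel : ∃ᶠ s in 𝓝[≠] s₀, 4 * g s 0 ^ 2 = 9 * ψ (D s) 1 * g s 1 ^ 2 := by
    refine (hfreq.and_eventually ((((hc.eventually_nhds.and hcomp).and hvertex).and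
      (hg'.continuousAt.eventually_ne hg0)).filter_mono nhdsWithin_le_nhds)).mono ?_
    rintro s ⟨h1, ⟨⟨h2, h3⟩, h4⟩, h5⟩
    have hv : ψ (D s) 1 ≠ 0 := fun h => (smul_ne_zero h1 h5) (h4 h)
    have h6 := ((h3 0).fun_pow 2).unique (((h3 1).fun_pow 3).congr_of_eventuallyEq h2)
    have h7 := h2.self_of_nhds
    have h8 : 2 * ψ (D s) 0 * g s 0 = 3 * ψ (D s) 1 ^ 2 * g s 1 := by
      apply mul_left_cancel₀ h1
      simp at h6
      linear_combination h6
    apply mul_left_cancel₀ (pow_ne_zero 3 hv)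
    linear_combination (2 * ψ (D s) 0 * g s 0 + 3 * ψ (D s) 1 ^ 2 * g s 1) * h8 -
      4 * g s 0 ^ 2 * h7
  have hgi : ∀ i, HasDerivAt (fun s => g s i) (fderiv ℝ ψ (D s₀) (deriv e s₀) i) s₀ :=
    hasDerivAt_pi.1 hg'
  have hg00 : g s₀ 0 = 0 := by
    by_contra h
    have hcont : ContinuousAt (fun s => 4 * g s 0 ^ 2 - 9 * ψ (D s) 1 * g s 1 ^ 2) s₀ :=
      (((hgi 0).continuousAt.pow 2).const_mul 4).sub
        (((hcomp.self_of_nhds 1).continuousAt.const_mul 9).mul ((hgi 1).continuousAt.pow 2))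
    have := hcont.eventually_ne (y := 0) (by simpa [hψ0] using h)
    exact hrel ((this.filter_mono nhdsWithin_le_nhds).mono fun s hs => sub_ne_zero.1 hs)
  have hp : fderiv ℝ ψ (D s₀) (deriv e s₀) 0 ≠ 0 := by
    intro h
    apply hdet
    have : fderiv ℝ ψ (D s₀) (e s₀) 0 = 0 := hg00
    rw [h, this]
    ring
  -- Here `v' = δ g₁` vanishes at `s₀` together with its derivative, by `δ s₀ = 0` and the
  -- assumption `δ' s₀ = 0`.
  have hv2 : Tendsto (fun s => ψ (D s) 1 / (s - s₀) ^ 2) (𝓝[≠] s₀) (𝓝 0) := by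
    refine tendsto_div_sq_of_hasDerivAt (v' := fun s => δ s * g s 1)
      (hcomp.mono fun s hs => hs 1) (by simp [hψ0]) (by simp [hδ0]) ?_
    simpa [hδ1, hδ0] using hδ'.fun_mul (hgi 1)
  have hlim : Tendsto (fun s => 4 * slope (fun s => g s 0) s₀ s ^ 2 -
      9 * (ψ (D s) 1 / (s - s₀) ^ 2) * g s 1 ^ 2) (𝓝[≠] s₀)
      (𝓝 (4 * fderiv ℝ ψ (D s₀) (deriv e s₀) 0 ^ 2 - 9 * 0 * g s₀ 1 ^ 2)) :=
    (((hasDerivAt_iff_tendsto_slope.1 (hgi 0)).pow 2).const_mul 4).sub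
      ((hv2.const_mul 9).mul
        (((hgi 1).continuousAt.tendsto.mono_left nhdsWithin_le_nhds).pow 2))
  have hne := hlim.eventually_ne (b₂ := 0) (by simpa using hp)
  obtain ⟨s, hs, hs', hs0⟩ := (hrel.and_eventually (hne.and self_mem_nhdsWithin)).exists
  apply hs'
  have hs0' : s - s₀ ≠ 0 := sub_ne_zero.2 hs0
  simp only [slope_def_field, hg00, sub_zero]
  field_simp
  linear_combination hs

/-! ### Sufficiency: a simple zero produces a cusp -/

/-- Away from the origin, a level set of the pseudo-scalar square is a graph over one of the
coordinate planes. -/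
theorem exists_graph_chart_lip (c : ℝ) {p : R31} (hp0 : p ≠ 0) :
    ∃ (V : Set R31) (W : Set R2) (Φ : R2 → R31) (Ψ : R31 →L[ℝ] R2), IsOpen V ∧ p ∈ V ∧
      IsOpen W ∧ ContDiffOn ℝ ∞ Φ W ∧ Φ '' W = {x | x ≠ 0 ∧ lip x x = c} ∩ V ∧
      ∀ y ∈ W, Ψ (Φ y) = y := by
  obtain ⟨i, hi⟩ : ∃ i, p i ≠ 0 := by
    by_contra! h
    exact hp0 (funext h)
  let σ : Fin 3 → ℝ := ![-1, 1, 1]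
  have hσ : ∀ j, σ j * σ j = 1 := fun j => by fin_cases j <;> simp [σ]
  have hlip : ∀ x : R31, lip x x =
      σ i * x i ^ 2 + ∑ j, σ (i.succAbove j) * x (i.succAbove j) ^ 2 := fun x => by
    rw [← Fin.sum_univ_succAbove (fun j => σ j * x j ^ 2) i, Fin.sum_univ_three]
    simp [σ, lip]
    ring
  -- The square of the `i`-th coordinate on the level set, in terms of the other two. The sign `g`
  -- of `p i` selects the sheet through `p`.
  let R : R2 → ℝ := fun y => σ i * (c - ∑ j, σ (i.succAbove j) * y j ^ 2)
  have hR : ContDiff ℝ ∞ R := by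
    simp only [R]
    fun_prop
  let g : ℝ := p i / |p i|
  have hg : g * g = 1 := by
    have : |p i| ≠ 0 := abs_ne_zero.2 hi
    simp only [g]
    field_simp
    exact (sq_abs _).symm
  have hgp : 0 < g * p i := by
    simp only [g]
    have : 0 < |p i| := abs_pos.2 hi
    rw [div_mul_eq_mul_div]
    have := mul_self_pos.2 hi
    positivity
  let Φ : R2 → R31 := fun y => i.insertNth (g * √(R y)) y
  let Ψ : R31 →L[ℝ] R2 :=
    ContinuousLinearMap.pi fun j => ContinuousLinearMap.proj (i.succAbove j)
  refine ⟨{x | 0 < x i * p i}, {y | 0 < R y}, Φ, Ψ, ?_, ?_, ?_, ?_, ?_, ?_⟩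
  · exact isOpen_lt continuous_const ((continuous_apply i).mul continuous_const)
  · exact mul_self_pos.2 hi
  · exact isOpen_lt continuous_const hR.continuous
  · rw [contDiffOn_pi]
    intro k
    induction k using Fin.succAboveCases i with
    | x =>
      simp only [Φ, Fin.insertNth_apply_same]
      exact contDiffOn_const.mul (hR.contDiffOn.sqrt fun y hy => ne_of_gt hy)
    | p j =>
      simp only [Φ, Fin.insertNth_apply_succAbove]
      exact (contDiff_apply ℝ ℝ j).contDiffOn
  · ext x
    constructor
    · rintro ⟨y, hy, rfl⟩
      have hy' : 0 < R y := hy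
      have h1 : 0 < Φ y i * p i := by
        simp only [Φ, Fin.insertNth_apply_same]
        rw [mul_right_comm]
        exact mul_pos hgp (Real.sqrt_pos.2 hy')
      refine ⟨⟨fun h => ?_, ?_⟩, h1⟩
      · rw [h] at h1
        simp at h1
      · rw [hlip]
        simp only [Φ, Fin.insertNth_apply_same, Fin.insertNth_apply_succAbove]
        rw [mul_pow, Real.sq_sqrt hy'.le, pow_two g, hg]
        simp only [R]
        linear_combination (c - ∑ j, σ (i.succAbove j) * y j ^ 2) * hσ i
    · rintro ⟨⟨-, hx⟩, hxi⟩
      rw [hlip] at hx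
      have hRx : R (Ψ x) = x i ^ 2 := by
        simp only [R, Ψ, ContinuousLinearMap.coe_pi', ContinuousLinearMap.proj_apply]
        rw [← hx]
        linear_combination x i ^ 2 * hσ i
      have hxi' : 0 < x i * p i := hxi
      have hxi0 : x i ≠ 0 := by rintro h; rw [h] at hxi'; simp at hxi'
      refine ⟨Ψ x, ?_, ?_⟩
      · change 0 < R (Ψ x)
        rw [hRx]
        positivity
      · have hgx : 0 < g * x i := by
          have h2 : g * x i = x i * p i / |p i| := by simp only [g]; ring
          rw [h2]
          exact div_pos hxi' (abs_pos.2 hi)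
        ext k
        induction k using Fin.succAboveCases i with
        | x =>
          simp only [Φ, Fin.insertNth_apply_same]
          have h3 : x i ^ 2 = (g * x i) ^ 2 := by
            rw [mul_pow, pow_two g, hg, one_mul]
          rw [hRx, h3, Real.sqrt_sq hgx.le]
          linear_combination x i * hg
        | p j =>
          simp only [Φ, Fin.insertNth_apply_succAbove]
          rfl
  · intro y hy
    ext j
    simp [Φ, Ψ]

theorem exists_eq_of_mem_cusp {x : R2} (hx : x ∈ cusp) : ∃ t : ℝ, x = ![t ^ 3, t ^ 2] := by
  have hx' : x 0 ^ 2 = x 1 ^ 3 := hx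
  by_cases h : x 1 = 0
  · refine ⟨0, ?_⟩
    have h0 : x 0 = 0 := by
      rw [h] at hx'
      simpa using hx'
    ext i; fin_cases i <;> simp [h, h0]
  · refine ⟨x 0 / x 1, ?_⟩
    ext i; fin_cases i
    · simp only [Fin.zero_eta, Matrix.cons_val_zero]
      field_simp
      linear_combination -x 0 * hx'
    · simp only [Fin.mk_one, Matrix.cons_val_one]
      simp only [Matrix.cons_val_fin_one]
      field_simp
      linear_combination -hx'

/-- A curve with velocity `δ • e`, with `e` and `e'` linearly independent and `δ` having a simple
zero, has an ordinary cusp as image. -/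
theorem imageLocallyCuspAt_of_simple_zero {Q : Set R31} {c : ℝ}
    (hQ : Q = {x | x ≠ 0 ∧ lip x x = c}) {D e : ℝ → R31} {δ : ℝ → ℝ} {s₀ : ℝ}
    {N : Set ℝ} (hN : IsOpen N) (hs₀ : s₀ ∈ N) (hDs : ContDiffOn ℝ ∞ D N)
    (he : ContDiffOn ℝ ∞ e N) (hδ : ContDiffOn ℝ ∞ δ N)
    (hD : ∀ s ∈ N, HasDerivAt D (δ s • e s) s) (hDQ : ∀ s ∈ N, D s ∈ Q)
    (hli : LinearIndependent ℝ ![e s₀, deriv e s₀]) (h0 : δ s₀ = 0) (h1 : deriv δ s₀ ≠ 0) :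
    ImageLocallyCuspAt Q D s₀ := by
  subst hQ
  have hNn : N ∈ 𝓝 s₀ := hN.mem_nhds hs₀
  obtain ⟨V₀, W₀, Φ, Ψ, hV₀, hpV, hW₀, hΦ, hΦW, hΨΦ⟩ :=
    exists_graph_chart_lip c (hDQ s₀ hs₀).1
  have hΦΨ : ∀ x ∈ {x | x ≠ 0 ∧ lip x x = c} ∩ V₀, Ψ x ∈ W₀ ∧ Φ (Ψ x) = x := by
    intro x hx
    rw [← hΦW] at hx
    obtain ⟨y, hy, rfl⟩ := hx
    rw [hΨΦ y hy]
    exact ⟨hy, rfl⟩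
  have he' : HasDerivAt e (deriv e s₀) s₀ :=
    ((he.contDiffAt hNn).differentiableAt (by simp)).hasDerivAt
  have hδ' : HasDerivAt δ (deriv δ s₀) s₀ :=
    ((hδ.contDiffAt hNn).differentiableAt (by simp)).hasDerivAt
  have hDc : ContinuousAt D s₀ := (hD s₀ hs₀).continuousAt
  have hDV : ∀ᶠ s in 𝓝 s₀, s ∈ N ∧ D s ∈ V₀ :=
    (show ∀ᶠ s in 𝓝 s₀, s ∈ N from hNn).and (hDc.eventually (hV₀.mem_nhds hpV))
  have heq : ∀ᶠ s in 𝓝 s₀, Φ (Ψ (D s)) = D s := by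
    filter_upwards [hDV] with s hs using (hΦΨ _ ⟨hDQ s hs.1, hs.2⟩).2
  have hfreq : ∃ᶠ s in 𝓝[≠] s₀, δ s ≠ 0 := by
    have := hδ'.eventually_ne (c := 0) h1
    exact this.frequently
  have hli' : LinearIndependent ℝ ![Ψ (e s₀), Ψ (deriv e s₀)] := by
    have := linearIndependent_fderiv_direction (ψ := Ψ)
      (by filter_upwards [hNn] with s hs using hD s hs) h0 hfreq Ψ.contDiff.contDiffAt
      (hΦ.contDiffAt (hW₀.mem_nhds (hΦΨ _ ⟨hDQ s₀ hs₀, hpV⟩).1)) heq he' hli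
    simpa using this
  have hdet := det_ne_zero_of_linearIndependent hli'
  -- the planar curve `z`, and coordinates `u`, `v` along the normal and the tangent at the cusp
  set z₀ : R2 := Ψ (D s₀) with hz₀
  -- The acceleration of the planar curve at `s₀`. Keeping the factor `deriv δ s₀` makes the second
  -- derivative of `ℓv` along the curve equal to `|q| ^ 2`, positive whatever the sign of `deriv δ
  -- s₀`.
  set q : R2 := deriv δ s₀ • Ψ (e s₀) with hq
  have hqn : 0 < q 0 ^ 2 + q 1 ^ 2 := by
    have : Ψ (e s₀) 0 ≠ 0 ∨ Ψ (e s₀) 1 ≠ 0 := by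
      by_contra! h
      rw [h.1, h.2] at hdet
      simp at hdet
    simp only [hq, Pi.smul_apply, smul_eq_mul]
    rcases this with h | h
    · have : 0 < (deriv δ s₀ * Ψ (e s₀) 0) ^ 2 := by positivity
      positivity
    · have : 0 < (deriv δ s₀ * Ψ (e s₀) 1) ^ 2 := by positivity
      positivity
  let ℓu : R2 → ℝ := fun z => (z 0 - z₀ 0) * q 1 - (z 1 - z₀ 1) * q 0
  let ℓv : R2 → ℝ := fun z => (z 0 - z₀ 0) * q 0 + (z 1 - z₀ 1) * q 1
  have hℓu : ContDiff ℝ ∞ ℓu := by simp only [ℓu]; fun_prop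
  have hℓv : ContDiff ℝ ∞ ℓv := by simp only [ℓv]; fun_prop
  let ι : ℝ → ℝ → R2 := fun a b =>
    ![z₀ 0 + (a * q 1 + b * q 0) / (q 0 ^ 2 + q 1 ^ 2),
      z₀ 1 + (b * q 1 - a * q 0) / (q 0 ^ 2 + q 1 ^ 2)]
  have hι : ∀ z, ι (ℓu z) (ℓv z) = z := by
    intro z
    ext k; fin_cases k <;> simp [ι, ℓu, ℓv] <;> field_simp <;> ring
  have hℓuι : ∀ a b, ℓu (ι a b) = a := by
    intro a b
    simp [ι, ℓu]; field_simp; ring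
  have hℓvι : ∀ a b, ℓv (ι a b) = b := by
    intro a b
    simp [ι, ℓv]; field_simp; ring
  let z : ℝ → R2 := fun s => Ψ (D (s₀ + s))
  have hshift : ContDiff ℝ ∞ fun s : ℝ => s₀ + s := contDiff_const.add contDiff_id
  have hN' : IsOpen ((fun s => s₀ + s) ⁻¹' N) := hN.preimage hshift.continuous
  have hzs : ContDiffOn ℝ ∞ z ((fun s => s₀ + s) ⁻¹' N) :=
    Ψ.contDiff.comp_contDiffOn (hDs.comp hshift.contDiffOn fun s hs => hs)
  have hzd : ∀ s ∈ (fun s => s₀ + s) ⁻¹' N, ∀ k,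
      HasDerivAt (fun s => z s k) (δ (s₀ + s) * Ψ (e (s₀ + s)) k) s := by
    intro s hs k
    have h2 : HasDerivAt (fun s => D (s₀ + s)) (δ (s₀ + s) • e (s₀ + s)) s :=
      (hD (s₀ + s) hs).comp_const_add s₀ s
    have h3 := Ψ.hasFDerivAt.comp_hasDerivAt s h2
    rw [map_smul] at h3
    simpa using hasDerivAt_pi.1 h3 k
  let mu : ℝ → ℝ := fun s => Ψ (e (s₀ + s)) 0 * q 1 - Ψ (e (s₀ + s)) 1 * q 0
  let mv : ℝ → ℝ := fun s => Ψ (e (s₀ + s)) 0 * q 0 + Ψ (e (s₀ + s)) 1 * q 1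
  have hud : ∀ s ∈ (fun s => s₀ + s) ⁻¹' N,
      HasDerivAt (fun s => ℓu (z s)) (δ (s₀ + s) * mu s) s := by
    intro s hs
    convert! (((hzd s hs 0).sub_const (z₀ 0)).mul_const (q 1)).sub
      (((hzd s hs 1).sub_const (z₀ 1)).mul_const (q 0)) using 1
    simp only [mu]; ring
  have hvd : ∀ s ∈ (fun s => s₀ + s) ⁻¹' N,
      HasDerivAt (fun s => ℓv (z s)) (δ (s₀ + s) * mv s) s := by
    intro s hs
    convert! (((hzd s hs 0).sub_const (z₀ 0)).mul_const (q 0)).add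
      (((hzd s hs 1).sub_const (z₀ 1)).mul_const (q 1)) using 1
    simp only [mv]; ring
  have h0N : (0 : ℝ) ∈ (fun s => s₀ + s) ⁻¹' N := by simpa using hs₀
  have hNn' := hN'.mem_nhds h0N
  have hes : ∀ k, HasDerivAt (fun s => Ψ (e (s₀ + s)) k) (Ψ (deriv e s₀) k) 0 := by
    intro k
    have h2 : HasDerivAt (fun s => e (s₀ + s)) (deriv e s₀) 0 :=
      HasDerivAt.comp_const_add s₀ 0 (by simpa using he')
    simpa using hasDerivAt_pi.1 (Ψ.hasFDerivAt.comp_hasDerivAt 0 h2) k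
  have hmu : HasDerivAt mu (Ψ (deriv e s₀) 0 * q 1 - Ψ (deriv e s₀) 1 * q 0) 0 :=
    ((hes 0).mul_const _).sub ((hes 1).mul_const _)
  have hmv : HasDerivAt mv (Ψ (deriv e s₀) 0 * q 0 + Ψ (deriv e s₀) 1 * q 1) 0 :=
    ((hes 0).mul_const _).add ((hes 1).mul_const _)
  have hδs : HasDerivAt (fun s => δ (s₀ + s)) (deriv δ s₀) 0 :=
    HasDerivAt.comp_const_add s₀ 0 (by simpa using hδ')
  have hmv0 : deriv δ s₀ * mv 0 = q 0 ^ 2 + q 1 ^ 2 := by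
    simp only [mv, hq, add_zero, Pi.smul_apply, smul_eq_mul]
    ring
  have hmv0' : mv 0 ≠ 0 := by
    intro h
    rw [h, mul_zero] at hmv0
    exact hqn.ne hmv0
  have hmu0 : mu 0 = 0 := by
    simp only [mu, hq, add_zero, Pi.smul_apply, smul_eq_mul]
    ring
  have hderivv : deriv (fun s => ℓv (z s)) =ᶠ[𝓝 0] fun s => δ (s₀ + s) * mv s := by
    filter_upwards [hNn'] with s hs using (hvd s hs).deriv
  have hvv : deriv (deriv fun s => ℓv (z s)) 0 = q 0 ^ 2 + q 1 ^ 2 := by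
    rw [hderivv.deriv_eq, (hδs.fun_mul hmv).deriv, add_zero, h0, zero_mul, add_zero, hmv0]
  have hz0 : z 0 = z₀ := by simp [z, hz₀]
  obtain ⟨a, b, τ, τ', ha, hb, hb0, hτ0, hτ, hτ', hab⟩ :=
    exists_cusp_parameter (u := fun s => ℓu (z s)) (v := fun s => ℓv (z s))
      (m := fun s => mu s / mv s) hN' h0N (hℓu.comp_contDiffOn hzs) (hℓv.comp_contDiffOn hzs)
      (by simp [hz0, ℓv]) (by rw [(hvd 0 h0N).deriv, add_zero, h0, zero_mul])
      (by rw [hvv]; exact hqn)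
      (by
        filter_upwards [hNn', hmv.continuousAt.eventually_ne hmv0'] with s hs hs'
        rw [(hud s hs).deriv, (hvd s hs).deriv]
        field_simp)
      (hmu.fun_div hmv hmv0')
      (by
        rw [hmu0, zero_mul, sub_zero]
        -- The numerator is `-deriv δ s₀` times the determinant of `Ψ (e s₀)` and `Ψ (deriv e s₀)`,
        -- multiplied by `mv 0`.
        refine div_ne_zero (mul_ne_zero ?_ hmv0') (pow_ne_zero 2 hmv0')
        simp only [hq, Pi.smul_apply, smul_eq_mul]
        intro h
        apply mul_ne_zero h1 hdet
        linear_combination -h)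
  -- the diffeomorphism
  let h : R2 → R2 := fun x => ι (a (x 1) + x 0 * b (x 1)) (x 1)
  let k : R2 → R2 := fun y => ![(ℓu y - a (ℓv y)) / b (ℓv y), ℓv y]
  have hhc : ContDiff ℝ ∞ h := by
    have hu : ContDiff ℝ ∞ fun x : R2 => a (x 1) + x 0 * b (x 1) :=
      (ha.comp (contDiff_apply ℝ ℝ 1)).add
        ((contDiff_apply ℝ ℝ 0).mul (hb.comp (contDiff_apply ℝ ℝ 1)))
    have hv : ContDiff ℝ ∞ fun x : R2 => x 1 := contDiff_apply ℝ ℝ 1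
    refine contDiff_pi.2 fun i => ?_
    fin_cases i
    · exact contDiff_const.add (((hu.mul contDiff_const).add (hv.mul contDiff_const)).div_const _)
    · exact contDiff_const.add (((hv.mul contDiff_const).sub (hu.mul contDiff_const)).div_const _)
  have hkc : ContDiffOn ℝ ∞ k {y | b (ℓv y) ≠ 0} := by
    refine contDiffOn_pi.2 fun i => ?_
    fin_cases i
    · exact (hℓu.sub (ha.comp hℓv)).contDiffOn.div (hb.comp hℓv).contDiffOn fun y hy => hy
    · exact hℓv.contDiffOn
  have hvh : ∀ x, ℓv (h x) = x 1 := fun x => hℓvι _ _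
  have huh : ∀ x, ℓu (h x) = a (x 1) + x 0 * b (x 1) := fun x => hℓuι _ _
  have hh0 : h 0 = z₀ := by
    have := (hab.self_of_nhds)
    simp only [hτ0, hz0] at this
    rw [← hι z₀, this.1, this.2]
    simp [h]
  have hkh : ∀ x, b (x 1) ≠ 0 → k (h x) = x := by
    intro x hx
    ext i; fin_cases i
    · simp [k, hvh, huh, hx]
    · simp [k, hvh]
  have hhk : ∀ y, b (ℓv y) ≠ 0 → h (k y) = y := by
    intro y hy
    have e1 : k y 1 = ℓv y := rfl
    have e0 : k y 0 = (ℓu y - a (ℓv y)) / b (ℓv y) := rfl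
    simp only [h, e0, e1]
    rw [div_mul_cancel₀ _ hy, add_sub_cancel, hι]
  have hD0 : ∀ᶠ s in 𝓝 (0 : ℝ), s₀ + s ∈ N ∧ D (s₀ + s) ∈ V₀ := by
    refine Tendsto.eventually (f := fun s : ℝ => s₀ + s) ?_ hDV
    simpa using hshift.continuous.tendsto 0
  obtain ⟨ε₀, hε₀, hball⟩ := Metric.eventually_nhds_iff_ball.1 (hD0.and hab)
  filter_upwards [Ioo_mem_nhdsGT hε₀] with ε hε
  -- The map `τ` is open at the origin, so every `t` with `|t| < η` is some `τ s` with `|s| < ε`.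
  -- The bound `|x 1| < η ^ 2` below thus keeps only cusp points reached by the short arc.
  have hτim : τ '' Metric.ball 0 ε ∈ 𝓝 0 := by
    have := image_mem_map (m := τ) (Metric.ball_mem_nhds (0 : ℝ) hε.1)
    rwa [hτ.map_nhds_eq hτ', hτ0] at this
  obtain ⟨η, hη, hητ⟩ := Metric.mem_nhds_iff.1 hτim
  have hz : ∀ s, D (s₀ + s) ∈ V₀ → s₀ + s ∈ N → Φ (z s) = D (s₀ + s) := fun s h2 h3 =>
    (hΦΨ _ ⟨hDQ _ h3, h2⟩).2
  have hzh : ∀ s ∈ Metric.ball (0 : ℝ) ε₀, z s = h ![τ s ^ 3, τ s ^ 2] := by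
    intro s hs
    have h2 := (hball s hs).2
    simp only [h, Matrix.cons_val_zero, Matrix.cons_val_one, Matrix.cons_val_fin_one]
    rw [← h2.2, ← h2.1, hι]
  have hsub : Metric.ball (0 : ℝ) ε ⊆ Metric.ball 0 ε₀ := Metric.ball_subset_ball hε.2.le
  have hc1 : Continuous fun x : R2 => x 1 := continuous_apply 1
  refine ⟨{x | b (x 1) ≠ 0 ∧ |x 1| < η ^ 2 ∧ h x ∈ W₀},
    {x | b (ℓv (Ψ x)) ≠ 0 ∧ |ℓv (Ψ x)| < η ^ 2 ∧ x ∈ V₀}, fun x => Φ (h x), fun x => k (Ψ x),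
    ?_, ?_, ?_, ?_, ?_, ?_, ?_, ?_, ?_⟩
  · exact ((hb.continuous.comp hc1).isOpen_preimage _ isOpen_compl_singleton).inter
      ((isOpen_lt hc1.abs continuous_const).inter (hW₀.preimage hhc.continuous))
  · have hc2 := hℓv.continuous.comp Ψ.continuous
    exact ((hb.continuous.comp hc2).isOpen_preimage _ isOpen_compl_singleton).inter
      ((isOpen_lt hc2.abs continuous_const).inter hV₀)
  · refine ⟨hb0, by simpa using pow_pos hη 2, ?_⟩
    rw [hh0]
    exact (hΦΨ _ ⟨hDQ s₀ hs₀, hpV⟩).1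
  · simp only [hh0]
    exact (hΦΨ _ ⟨hDQ s₀ hs₀, hpV⟩).2
  · exact hΦ.comp hhc.contDiffOn fun x hx => hx.2.2
  · exact hkc.comp Ψ.contDiff.contDiffOn fun x hx => hx.1
  · ext x
    constructor
    · rintro ⟨y, ⟨hy1, hy2, hy3⟩, rfl⟩
      have h2 : Φ (h y) ∈ {x | x ≠ 0 ∧ lip x x = c} ∩ V₀ := hΦW ▸ Set.mem_image_of_mem Φ hy3
      refine ⟨h2.1, ?_, ?_, h2.2⟩ <;> rw [hΨΦ _ hy3, hvh]
      · exact hy1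
      · exact hy2
    · rintro ⟨hx, hx1, hx2, hx3⟩
      have h2 := hΦΨ x ⟨hx, hx3⟩
      refine ⟨k (Ψ x), ⟨hx1, hx2, ?_⟩, ?_⟩
      · rw [hhk _ hx1]; exact h2.1
      · simp only [hhk _ hx1, h2.2]
  · rintro x ⟨hx1, -, hx3⟩
    simp only [hΨΦ _ hx3, hkh x hx1]
  · ext x
    constructor
    · rintro ⟨y, ⟨hyc, hy1, hy2, hy3⟩, rfl⟩
      have h2 : Φ (h y) ∈ {x | x ≠ 0 ∧ lip x x = c} ∩ V₀ := hΦW ▸ Set.mem_image_of_mem Φ hy3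
      refine ⟨?_, ?_, ?_, h2.2⟩
      · obtain ⟨t, rfl⟩ := exists_eq_of_mem_cusp hyc
        have ht : t ∈ Metric.ball (0 : ℝ) η := by
          rw [mem_ball_zero_iff, Real.norm_eq_abs]
          simp only [Matrix.cons_val_one, Matrix.cons_val_fin_one, abs_pow] at hy2
          exact lt_of_pow_lt_pow_left₀ 2 hη.le hy2
        obtain ⟨s, hs, rfl⟩ := hητ ht
        have h3 := (hball s (hsub hs)).1
        refine ⟨s₀ + s, ?_, ?_⟩
        · rw [Real.ball_eq_Ioo] at hs
          constructor <;> linarith [hs.1, hs.2]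
        · rw [← hz s h3.2 h3.1, hzh s (hsub hs)]
      · rw [hΨΦ _ hy3, hvh]; exact hy1
      · rw [hΨΦ _ hy3, hvh]; exact hy2
    · rintro ⟨⟨s', hs', rfl⟩, hx1, hx2, hx3⟩
      obtain ⟨s, rfl⟩ : ∃ s, s₀ + s = s' := ⟨s' - s₀, by ring⟩
      have hs : s ∈ Metric.ball (0 : ℝ) ε := by
        rw [Real.ball_eq_Ioo]
        constructor <;> linarith [hs'.1, hs'.2]
      have h3 := (hball s (hsub hs)).1
      have h4 := hzh s (hsub hs)
      have h5 : Φ (z s) = D (s₀ + s) := hz s h3.2 h3.1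
      have h6 : z s ∈ W₀ := (hΦΨ _ ⟨hDQ _ h3.1, h3.2⟩).1
      have h7 : ℓv (z s) = τ s ^ 2 := (hball s (hsub hs)).2.1
      refine ⟨![τ s ^ 3, τ s ^ 2], ⟨?_, ?_, ?_, ?_⟩, ?_⟩
      · change (τ s ^ 3) ^ 2 = (τ s ^ 2) ^ 3
        ring
      · change b (τ s ^ 2) ≠ 0
        rw [← h7]; exact hx1
      · change |τ s ^ 2| < _
        rw [← h7]; exact hx2
      · rw [← h4]; exact h6
      · simp only [← h4, h5]

theorem imageLocallyCuspAt_iff {Q : Set R31} {c : ℝ}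
    (hQ : Q = {x | x ≠ 0 ∧ lip x x = c}) {D e : ℝ → R31} {δ : ℝ → ℝ} {s₀ : ℝ}
    {N : Set ℝ} (hN : IsOpen N) (hs₀ : s₀ ∈ N) (hDs : ContDiffOn ℝ ∞ D N)
    (he : ContDiffOn ℝ ∞ e N) (hδ : ContDiffOn ℝ ∞ δ N)
    (hD : ∀ s ∈ N, HasDerivAt D (δ s • e s) s) (hDQ : ∀ s ∈ N, D s ∈ Q)
    (hli : LinearIndependent ℝ ![e s₀, deriv e s₀]) :
    (NonSingularAt D s₀ ↔ δ s₀ ≠ 0) ∧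
      (ImageLocallyCuspAt Q D s₀ ↔ δ s₀ = 0 ∧ deriv δ s₀ ≠ 0) := by
  refine ⟨?_, simple_zero_of_imageLocallyCuspAt hN hs₀ hDs he hδ hD hli, fun h =>
    imageLocallyCuspAt_of_simple_zero hQ hN hs₀ hDs he hδ hD hDQ hli h.1 h.2⟩
  have hne : e s₀ ≠ 0 := hli.ne_zero 0
  rw [NonSingularAt, (hD s₀ hs₀).deriv, ne_eq, smul_eq_zero, not_or]
  exact and_iff_left hne

/-! ### Calculus of the pseudo-scalar product and the vector product -/

theorem lip_comm (x y : R31) : lip x y = lip y x := by simp only [lip]; ring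

theorem lip_add_left (x y z : R31) : lip (x + y) z = lip x z + lip y z := by
  simp only [lip, Pi.add_apply]; ring

theorem lip_sub_left (x y z : R31) : lip (x - y) z = lip x z - lip y z := by
  simp only [lip, Pi.sub_apply]; ring

theorem lip_smul_left (a : ℝ) (x y : R31) : lip (a • x) y = a * lip x y := by
  simp only [lip, Pi.smul_apply, smul_eq_mul]; ring

theorem lip_add_right (x y z : R31) : lip x (y + z) = lip x y + lip x z := by
  rw [lip_comm, lip_add_left, lip_comm y, lip_comm z]

theorem lip_sub_right (x y z : R31) : lip x (y - z) = lip x y - lip x z := by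
  rw [lip_comm, lip_sub_left, lip_comm y, lip_comm z]

theorem lip_smul_right (a : ℝ) (x y : R31) : lip x (a • y) = a * lip x y := by
  rw [lip_comm, lip_smul_left, lip_comm y]

theorem lip_zero_left (y : R31) : lip 0 y = 0 := by simp [lip]

theorem eq_of_forall_lip_eq {x y : R31} (h : ∀ z, lip x z = lip y z) : x = y := by
  ext k
  have h0 := h ![1, 0, 0]
  have h1 := h ![0, 1, 0]
  have h2 := h ![0, 0, 1]
  simp [lip] at h0 h1 h2
  fin_cases k <;> assumption

theorem HasDerivAt.lip {f g : ℝ → R31} {f' g' : R31} {s : ℝ} (hf : HasDerivAt f f' s)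
    (hg : HasDerivAt g g' s) :
    HasDerivAt (fun s => lip (f s) (g s)) (lip f' (g s) + lip (f s) g') s := by
  have hf' := hasDerivAt_pi.1 hf
  have hg' := hasDerivAt_pi.1 hg
  convert! ((((hf' 0).mul (hg' 0)).neg).add ((hf' 1).mul (hg' 1))).add ((hf' 2).mul (hg' 2)) using 1
  simp only [LorentzDarboux.lip]
  ring

theorem ContDiffOn.lip {E : Type*} [NormedAddCommGroup E] [NormedSpace ℝ E] {f g : E → R31}
    {s : Set E} {n : WithTop ℕ∞} (hf : ContDiffOn ℝ n f s) (hg : ContDiffOn ℝ n g s) :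
    ContDiffOn ℝ n (fun x => lip (f x) (g x)) s := by
  have hf' := contDiffOn_pi.1 hf
  have hg' := contDiffOn_pi.1 hg
  exact ((((hf' 0).mul (hg' 0)).neg).add ((hf' 1).mul (hg' 1))).add ((hf' 2).mul (hg' 2))

theorem ContDiffOn.wedge {E : Type*} [NormedAddCommGroup E] [NormedSpace ℝ E] {f g : E → R31}
    {s : Set E} {n : WithTop ℕ∞} (hf : ContDiffOn ℝ n f s) (hg : ContDiffOn ℝ n g s) :
    ContDiffOn ℝ n (fun x => wedge (f x) (g x)) s := by
  have hf' := contDiffOn_pi.1 hf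
  have hg' := contDiffOn_pi.1 hg
  refine contDiffOn_pi.2 fun i => ?_
  fin_cases i
  · exact (((hf' 1).mul (hg' 2)).sub ((hf' 2).mul (hg' 1))).neg
  · exact (((hf' 0).mul (hg' 2)).sub ((hf' 2).mul (hg' 0))).neg
  · exact ((hf' 0).mul (hg' 1)).sub ((hf' 1).mul (hg' 0))

theorem lip_wedge_wedge (a b : R31) :
    lip (wedge a b) (wedge a b) = lip a b ^ 2 - lip a a * lip b b := by
  simp [lip, wedge]; ring

theorem lip_left_wedge (a b : R31) : lip a (wedge a b) = 0 := by
  simp [lip, wedge]; ring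

theorem lip_right_wedge (a b : R31) : lip b (wedge a b) = 0 := by
  simp [lip, wedge]; ring

/-- Expansion in a pseudo-orthonormal frame `t`, `n`, `t ∧ n`. -/
theorem eq_frame_expansion {t n : R31} (ht : lip t t = 1) (hn : lip n n = -1) (htn : lip t n = 0)
    (x : R31) : x = lip x t • t - lip x n • n + lip x (wedge t n) • wedge t n := by
  refine eq_of_forall_lip_eq fun y => ?_
  rw [lip_add_left, lip_sub_left, lip_smul_left, lip_smul_left, lip_smul_left]
  -- Pairing with `wedge t n` is a determinant up to sign, so the product is minus the determinant
  -- of the mixed Gram matrix of `x, t, n` against `y, t, n`.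
  have key : lip x (wedge t n) * lip (wedge t n) y =
      -(lip x y * (lip t t * lip n n - lip t n ^ 2)) + lip x t * lip t y * lip n n
      - lip x t * lip t n * lip n y - lip x n * lip t y * lip t n + lip x n * lip t t * lip n y := by
    simp [lip, wedge]; ring
  rw [key, ht, hn, htn]
  ring

/-! ### Pseudo-spherical images built from a moving frame -/

/-- The cusp criterion for the normalized vector `τ x - k y` (possibly shifted by the third frame
vector) of a moving pseudo-orthonormal frame `x`, `y`, `z`. The sign `σ` is the causal character
of `z`, and `ν` the sign of `k² - σ τ²`. -/
theorem frame_image_criterion {I : Set ℝ} (hI : IsOpen I) {x y z : ℝ → R31} {p k τ R : ℝ → ℝ}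
    {σ ν l : ℝ} (hσ : σ ^ 2 = 1) (hν : ν ^ 2 = 1) (hl : l ^ 2 = l)
    (hx : ∀ s ∈ I, HasDerivAt x (p s • y s + k s • z s) s)
    (hy : ∀ s ∈ I, HasDerivAt y ((σ * p s) • x s + τ s • z s) s)
    (hz : ∀ s ∈ I, HasDerivAt z (τ s • y s - (σ * k s) • x s) s)
    (hxs : ContDiffOn ℝ ∞ x I) (hys : ContDiffOn ℝ ∞ y I) (hzs : ContDiffOn ℝ ∞ z I)
    (hps : ContDiffOn ℝ ∞ p I) (hks : ContDiffOn ℝ ∞ k I) (hτs : ContDiffOn ℝ ∞ τ I)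
    (hxx : ∀ s ∈ I, lip (x s) (x s) = 1) (hyy : ∀ s ∈ I, lip (y s) (y s) = -σ)
    (hzz : ∀ s ∈ I, lip (z s) (z s) = σ) (hxy : ∀ s ∈ I, lip (x s) (y s) = 0)
    (hxz : ∀ s ∈ I, lip (x s) (z s) = 0) (hyz : ∀ s ∈ I, lip (y s) (z s) = 0)
    (hR : ∀ s, R s = ν * (k s ^ 2 - σ * τ s ^ 2)) {D : ℝ → R31}
    (hD : ∀ s, D s = (√(R s))⁻¹ • (τ s • x s - k s • y s) + l • z s) {δ : ℝ → ℝ}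
    (hδ : ∀ s, δ s = p s - σ * ν * (k s * deriv τ s - deriv k s * τ s) / R s + l * √(R s))
    {Q : Set R31} (hQ : Q = {x | x ≠ 0 ∧ lip x x = σ * (l - ν)})
    {s₀ : ℝ} (hs₀ : s₀ ∈ I) (hpos : 0 < R s₀) :
    (NonSingularAt D s₀ ↔ δ s₀ ≠ 0) ∧
      (ImageLocallyCuspAt Q D s₀ ↔ δ s₀ = 0 ∧ deriv δ s₀ ≠ 0) := by
  have hRs : ContDiffOn ℝ ∞ R I := by
    rw [funext hR]
    exact contDiffOn_const.mul ((hks.pow 2).sub (contDiffOn_const.mul (hτs.pow 2)))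
  have hN : IsOpen (I ∩ R ⁻¹' Set.Ioi 0) := hRs.continuousOn.isOpen_inter_preimage hI isOpen_Ioi
  have hNI : I ∩ R ⁻¹' Set.Ioi 0 ⊆ I := Set.inter_subset_left
  have hrs : ContDiffOn ℝ ∞ (fun s => √(R s)) (I ∩ R ⁻¹' Set.Ioi 0) :=
    (hRs.mono hNI).sqrt fun s hs => ne_of_gt hs.2
  have hris : ContDiffOn ℝ ∞ (fun s => (√(R s))⁻¹) (I ∩ R ⁻¹' Set.Ioi 0) :=
    hrs.inv fun s hs => (Real.sqrt_pos.2 hs.2).ne'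
  have hder : ∀ {f : ℝ → ℝ}, ContDiffOn ℝ ∞ f I → ∀ s ∈ I, HasDerivAt f (deriv f s) s :=
    fun hf s hs => ((hf.contDiffAt (hI.mem_nhds hs)).differentiableAt (by simp)).hasDerivAt
  have hr0 : ∀ s ∈ I ∩ R ⁻¹' Set.Ioi 0, √(R s) ≠ 0 := fun s hs => (Real.sqrt_pos.2 hs.2).ne'
  have hr2 : ∀ s ∈ I ∩ R ⁻¹' Set.Ioi 0, √(R s) ^ 2 = ν * (k s ^ 2 - σ * τ s ^ 2) :=
    fun s hs => by rw [Real.sq_sqrt (le_of_lt hs.2), hR]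
  -- The unit direction of `D'`, spanned by `x` and `y`; it satisfies `z' = √(R s) • e`.
  let e : ℝ → R31 := fun s => (√(R s))⁻¹ • (τ s • y s - (σ * k s) • x s)
  have hes : ContDiffOn ℝ ∞ e (I ∩ R ⁻¹' Set.Ioi 0) :=
    hris.smul (((hτs.smul hys).sub ((contDiffOn_const.mul hks).smul hxs)).mono hNI)
  have hkτ : ∀ s ∈ I ∩ R ⁻¹' Set.Ioi 0, τ s ≠ 0 ∨ k s ≠ 0 := by
    intro s hs
    by_contra! h
    have := hr2 s hs
    rw [h.1, h.2] at this
    exact hr0 s hs (by simpa using this)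
  have hσ0 : σ ≠ 0 := by rintro rfl; simp at hσ
  have hs₀' : s₀ ∈ I ∩ R ⁻¹' Set.Ioi 0 := ⟨hs₀, hpos⟩
  refine imageLocallyCuspAt_iff hQ (e := e) hN hs₀' ?_ hes ?_ ?_ ?_ ?_
  · rw [funext hD]
    exact (hris.smul (((hτs.smul hxs).sub (hks.smul hys)).mono hNI)).add
      ((hzs.mono hNI).const_smul l)
  · rw [funext hδ]
    refine ((hps.mono hNI).sub (ContDiffOn.div ?_ (hRs.mono hNI) fun s hs => ne_of_gt hs.2)).add
      (contDiffOn_const.mul hrs)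
    have h1 : ContDiffOn ℝ ∞ (deriv τ) I := hτs.deriv_of_isOpen hI (by simp)
    have h2 : ContDiffOn ℝ ∞ (deriv k) I := hks.deriv_of_isOpen hI (by simp)
    exact (contDiffOn_const.mul ((hks.mul h1).sub (h2.mul hτs))).mono hNI
  · intro s hs
    have hk' := hder hks s hs.1
    have hτ' := hder hτs s hs.1
    have hR' : HasDerivAt R (ν * (2 * k s * deriv k s - σ * (2 * τ s * deriv τ s))) s := by
      rw [funext hR]
      simpa using ((hk'.fun_pow 2).fun_sub ((hτ'.fun_pow 2).const_mul σ)).const_mul ν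
    have hr' := (hR'.sqrt (ne_of_gt hs.2)).fun_inv (hr0 s hs)
    have h1 := (hr'.fun_smul ((hτ'.fun_smul (hx s hs.1)).fun_sub
      (hk'.fun_smul (hy s hs.1)))).fun_add ((hz s hs.1).fun_const_smul l)
    rw [← funext hD] at h1
    convert! h1 using 1
    have h0 := hr0 s hs
    have h2 := hr2 s hs
    have hRr : R s = √(R s) ^ 2 := (Real.sq_sqrt (le_of_lt hs.2)).symm
    simp only [e]
    rw [hδ, hRr]
    rw [Real.sqrt_sq (Real.sqrt_nonneg _)]
    generalize √(R s) = r at *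
    ext i
    simp only [Pi.smul_apply, Pi.add_apply, Pi.sub_apply, smul_eq_mul]
    field_simp
    linear_combination (deriv k s * y s i - deriv τ s * x s i) * h2 +
      ν * k s * (k s * deriv τ s - deriv k s * τ s) * x s i * hσ
  · intro s hs
    rw [hQ]
    have h0 := hr0 s hs
    have h2 := hr2 s hs
    -- This is the pseudo-scalar square of `τ x - k y`; after normalization it is `-σ ν`, and the
    -- shift by `l z` adds `σ l`.
    have hσν : τ s ^ 2 - σ * k s ^ 2 = -σ * ν * √(R s) ^ 2 := by
      linear_combination (σ * ν) * h2 + (σ * k s ^ 2 - σ ^ 2 * τ s ^ 2) * hν - τ s ^ 2 * hσ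
    refine ⟨fun h => ?_, ?_⟩
    · have h3 : lip (D s) (x s) = 0 := by rw [h, lip_zero_left]
      have h4 : lip (D s) (y s) = 0 := by rw [h, lip_zero_left]
      rw [hD] at h3 h4
      simp only [lip_add_left, lip_sub_left, lip_smul_left, lip_comm (z s), hxx s hs.1,
        hyy s hs.1, hxy s hs.1, hxz s hs.1, hyz s hs.1, lip_comm (y s) (x s)] at h3 h4
      rcases hkτ s hs with h5 | h5
      · simp [h5, h0] at h3
      · simp [h5, h0, hσ0] at h4
    · rw [hD]
      simp only [lip_add_left, lip_sub_left, lip_smul_left, lip_add_right, lip_sub_right,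
        lip_smul_right, lip_comm (z s) (x s), lip_comm (z s) (y s), hxx s hs.1,
        hyy s hs.1, hzz s hs.1, hxy s hs.1, hxz s hs.1, hyz s hs.1, lip_comm (y s) (x s)]
      field_simp
      linear_combination hσν + √(R s) ^ 2 * σ * hl
  · have h0 := hr0 s₀ hs₀'
    have h2 := hr2 s₀ hs₀'
    -- Differentiating `⟨e, z⟩ = 0` gives `⟨e', z⟩ = -⟨e, z'⟩`, a nonzero multiple of `√(R s₀)`. As
    -- `e` itself is orthogonal to `z`, `e'` is not parallel to `e`.
    have hez : lip (deriv e s₀) (z s₀) ≠ 0 := by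
      have he' : HasDerivAt e (deriv e s₀) s₀ :=
        ((hes.contDiffAt (hN.mem_nhds hs₀')).differentiableAt (by simp)).hasDerivAt
      have h3 := he'.lip (hz s₀ hs₀)
      have h4 : (fun s => lip (e s) (z s)) =ᶠ[𝓝 s₀] fun _ => 0 := by
        filter_upwards [hI.mem_nhds hs₀] with s hs
        simp only [e, lip_smul_left, lip_sub_left, hxz s hs, hyz s hs]
        ring
      have h5 := (h3.congr_of_eventuallyEq h4.symm).unique (hasDerivAt_const s₀ (0 : ℝ))
      intro h6
      rw [h6, zero_add] at h5
      simp only [e, lip_sub_left, lip_smul_left, lip_sub_right, lip_smul_right,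
        lip_comm (y s₀) (x s₀), hxx s₀ hs₀, hyy s₀ hs₀, hxy s₀ hs₀] at h5
      have h7 : √(R s₀) ^ 2 = 0 := by
        have h8 : (√(R s₀))⁻¹ * (σ ^ 2 * k s₀ ^ 2 - σ * τ s₀ ^ 2) = 0 := by
          linear_combination h5
        have := (mul_eq_zero.1 h8).resolve_left (inv_ne_zero h0)
        rw [h2]
        linear_combination ν * this - ν * (k s₀ ^ 2) * hσ
      exact h0 (by simpa using h7)
    have hez0 : lip (e s₀) (z s₀) = 0 := by
      simp only [e, lip_smul_left, lip_sub_left, hxz s₀ hs₀, hyz s₀ hs₀]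
      ring
    rw [LinearIndependent.pair_iff]
    intro a b hab
    have hb : b = 0 := by
      have h3 : lip (a • e s₀ + b • deriv e s₀) (z s₀) = 0 := by rw [hab, lip_zero_left]
      rw [lip_add_left, lip_smul_left a, lip_smul_left b, hez0, mul_zero, zero_add] at h3
      exact (mul_eq_zero.1 h3).resolve_right hez
    refine ⟨?_, hb⟩
    rw [hb, zero_smul, add_zero] at hab
    refine (smul_eq_zero.1 hab).resolve_right fun h => ?_
    have h3 : lip (e s₀) (x s₀) = 0 := by rw [h, lip_zero_left]
    have h4 : lip (e s₀) (y s₀) = 0 := by rw [h, lip_zero_left]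
    simp only [e, lip_sub_left, lip_smul_left, hxx s₀ hs₀,
      hyy s₀ hs₀, hxy s₀ hs₀, lip_comm (y s₀) (x s₀)] at h3 h4
    rcases hkτ s₀ hs₀' with h5 | h5
    · simp [h5, h0, hσ0] at h4
    · simp [h5, h0, hσ0] at h3

/-! ### The Lorentzian Darboux frame -/

namespace LorentzDarboux

theorem SpacelikeSurface.fderiv_apply (M : SpacelikeSurface) (u w : R2) :
    fderiv ℝ M.X u w = w 0 • partialD M.X 0 u + w 1 • partialD M.X 1 u := by
  have hw : w = w 0 • (Pi.single 0 1 : R2) + w 1 • (Pi.single 1 1 : R2) := by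
    ext i; fin_cases i <;> simp
  conv_lhs => rw [hw]
  rw [map_add, map_smul, map_smul]
  rfl

/-- The square of the vector product is minus the Gram determinant of its factors, and that
determinant is positive on a spacelike plane. -/
theorem SpacelikeSurface.lip_wedge_neg (M : SpacelikeSurface) {u : R2} (hu : u ∈ M.U) :
    lip (wedge (partialD M.X 0 u) (partialD M.X 1 u))
      (wedge (partialD M.X 0 u) (partialD M.X 1 u)) < 0 := by
  rw [lip_wedge_wedge]
  have h := M.spacelike u hu
  simp only [M.fderiv_apply] at h
  generalize partialD M.X 0 u = a at *
  generalize partialD M.X 1 u = b at *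
  have h1 : 0 < lip b b := by
    simpa using h ![0, 1] (fun h => by simpa using congrFun h 1)
  -- The Gram-Schmidt vector `⟨b, b⟩ a - ⟨a, b⟩ b` has square `⟨b, b⟩` times the Gram determinant.
  have h2 := h ![lip b b, -lip a b] (fun h => h1.ne' (by simpa using congrFun h 0))
  simp only [Matrix.cons_val_zero, Matrix.cons_val_one, Matrix.cons_val_fin_one, lip_add_left,
    lip_add_right, lip_smul_left, lip_smul_right, lip_comm b a] at h2
  have h3 : 0 < lip b b * (lip a a * lip b b - lip a b ^ 2) := by
    convert! h2 using 1
    ring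
  linarith [pos_of_mul_pos_right h3 h1.le]

theorem SpacelikeSurface.pnorm_wedge_sq (M : SpacelikeSurface) {u : R2} (hu : u ∈ M.U) :
    pnorm (wedge (partialD M.X 0 u) (partialD M.X 1 u)) ^ 2 =
      -lip (wedge (partialD M.X 0 u) (partialD M.X 1 u))
        (wedge (partialD M.X 0 u) (partialD M.X 1 u)) := by
  rw [pnorm, abs_of_neg (M.lip_wedge_neg hu), Real.sq_sqrt]
  linarith [M.lip_wedge_neg hu]

theorem SpacelikeSurface.pnorm_wedge_ne_zero (M : SpacelikeSurface) {u : R2} (hu : u ∈ M.U) :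
    pnorm (wedge (partialD M.X 0 u) (partialD M.X 1 u)) ≠ 0 := by
  intro h
  have := M.pnorm_wedge_sq hu
  rw [h] at this
  linarith [M.lip_wedge_neg hu]

theorem SpacelikeSurface.lip_unitNormal_self (M : SpacelikeSurface) {u : R2} (hu : u ∈ M.U) :
    lip (unitNormal M.X u) (unitNormal M.X u) = -1 := by
  have h0 := M.pnorm_wedge_ne_zero hu
  have h2 := M.pnorm_wedge_sq hu
  rw [unitNormal, lip_smul_left, lip_smul_right]
  field_simp
  linear_combination h2

theorem SpacelikeSurface.lip_fderiv_unitNormal (M : SpacelikeSurface) (u w : R2) :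
    lip (fderiv ℝ M.X u w) (unitNormal M.X u) = 0 := by
  rw [M.fderiv_apply, unitNormal, lip_smul_right, lip_add_left, lip_smul_left, lip_smul_left,
    lip_left_wedge, lip_right_wedge]
  ring

theorem SpacelikeSurface.contDiffOn_unitNormal (M : SpacelikeSurface) :
    ContDiffOn ℝ ∞ (unitNormal M.X) M.U := by
  have hp : ∀ i, ContDiffOn ℝ ∞ (partialD M.X i) M.U := fun i =>
    (M.smooth.fderiv_of_isOpen M.isOpen_U (by simp)).clm_apply contDiffOn_const
  have hw := (hp 0).wedge (hp 1)
  have hn : ContDiffOn ℝ ∞ (fun u => pnorm (wedge (partialD M.X 0 u) (partialD M.X 1 u))) M.U := by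
    refine ((hw.lip hw).neg.sqrt fun u hu => ?_).congr fun u hu => ?_
    · linarith [M.lip_wedge_neg hu]
    · rw [pnorm, abs_of_neg (M.lip_wedge_neg hu)]
  exact (hn.inv fun u hu => M.pnorm_wedge_ne_zero hu).smul hw

namespace UnitSpeedCurve

variable {M : SpacelikeSurface} (c : UnitSpeedCurve M)

theorem contDiffOn_γ : ContDiffOn ℝ ∞ c.γ c.I := M.smooth.comp c.smooth c.mapsTo

theorem contDiffOn_t : ContDiffOn ℝ ∞ c.t c.I := c.contDiffOn_γ.deriv_of_isOpen c.isOpen_I (by simp)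

theorem contDiffOn_n : ContDiffOn ℝ ∞ c.n c.I := M.contDiffOn_unitNormal.comp c.smooth c.mapsTo

theorem contDiffOn_b : ContDiffOn ℝ ∞ c.b c.I := c.contDiffOn_t.wedge c.contDiffOn_n

theorem contDiffOn_κn : ContDiffOn ℝ ∞ c.κn c.I :=
  ((c.contDiffOn_t.deriv_of_isOpen c.isOpen_I (by simp)).lip c.contDiffOn_n).neg

theorem contDiffOn_κg : ContDiffOn ℝ ∞ c.κg c.I :=
  (c.contDiffOn_t.deriv_of_isOpen c.isOpen_I (by simp)).lip c.contDiffOn_b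

theorem contDiffOn_τg : ContDiffOn ℝ ∞ c.τg c.I :=
  ((c.contDiffOn_b.deriv_of_isOpen c.isOpen_I (by simp)).lip c.contDiffOn_n).neg

variable {c} {s : ℝ}

theorem lip_t_t (hs : s ∈ c.I) : lip (c.t s) (c.t s) = 1 := c.unit_speed s hs

theorem lip_n_n (hs : s ∈ c.I) : lip (c.n s) (c.n s) = -1 := M.lip_unitNormal_self (c.mapsTo hs)

theorem lip_t_n (hs : s ∈ c.I) : lip (c.t s) (c.n s) = 0 := by
  have h1 : HasFDerivAt M.X (fderiv ℝ M.X (c.γbar s)) (c.γbar s) :=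
    ((M.smooth.contDiffAt (M.isOpen_U.mem_nhds (c.mapsTo hs))).differentiableAt
      (by simp)).hasFDerivAt
  have h2 : HasDerivAt c.γbar (deriv c.γbar s) s :=
    ((c.smooth.contDiffAt (c.isOpen_I.mem_nhds hs)).differentiableAt (by simp)).hasDerivAt
  have h3 : c.t s = fderiv ℝ M.X (c.γbar s) (deriv c.γbar s) := (h1.comp_hasDerivAt s h2).deriv
  rw [h3]
  exact M.lip_fderiv_unitNormal _ _

theorem lip_t_b : lip (c.t s) (c.b s) = 0 := lip_left_wedge _ _

theorem lip_n_b : lip (c.n s) (c.b s) = 0 := lip_right_wedge _ _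

theorem lip_b_b (hs : s ∈ c.I) : lip (c.b s) (c.b s) = 1 := by
  rw [b, lip_wedge_wedge, lip_t_t hs, lip_n_n hs, lip_t_n hs]
  ring

theorem hasDerivAt_of_contDiffOn {f : ℝ → R31} (hf : ContDiffOn ℝ ∞ f c.I) (hs : s ∈ c.I) :
    HasDerivAt f (deriv f s) s :=
  ((hf.contDiffAt (c.isOpen_I.mem_nhds hs)).differentiableAt (by simp)).hasDerivAt

theorem lip_deriv_add_eq_zero {f g : ℝ → R31} (hf : ContDiffOn ℝ ∞ f c.I)
    (hg : ContDiffOn ℝ ∞ g c.I) {a : ℝ} (hfg : ∀ s ∈ c.I, lip (f s) (g s) = a) (hs : s ∈ c.I) :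
    lip (deriv f s) (g s) + lip (f s) (deriv g s) = 0 := by
  have h1 := (hasDerivAt_of_contDiffOn hf hs).lip (hasDerivAt_of_contDiffOn hg hs)
  refine h1.unique ((hasDerivAt_const s a).congr_of_eventuallyEq ?_)
  filter_upwards [c.isOpen_I.mem_nhds hs] with r hr using hfg r hr

/-- The Frenet-type equation for `t`. -/
theorem hasDerivAt_t (hs : s ∈ c.I) :
    HasDerivAt c.t (c.κn s • c.n s + c.κg s • c.b s) s := by
  convert! hasDerivAt_of_contDiffOn c.contDiffOn_t hs using 1
  rw [eq_frame_expansion (lip_t_t hs) (lip_n_n hs) (lip_t_n hs) (deriv c.t s)]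
  have h1 := lip_deriv_add_eq_zero c.contDiffOn_t c.contDiffOn_t (fun _ h => lip_t_t h) hs
  have h2 : lip (deriv c.t s) (c.t s) = 0 := by
    rw [lip_comm (c.t s)] at h1
    linarith
  rw [h2, κn, κg, b]
  module

/-- The Frenet-type equation for `n`. -/
theorem hasDerivAt_n (hs : s ∈ c.I) :
    HasDerivAt c.n (c.κn s • c.t s + c.τg s • c.b s) s := by
  convert! hasDerivAt_of_contDiffOn c.contDiffOn_n hs using 1
  rw [eq_frame_expansion (lip_t_t hs) (lip_n_n hs) (lip_t_n hs) (deriv c.n s)]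
  have h1 := lip_deriv_add_eq_zero c.contDiffOn_n c.contDiffOn_n (fun _ h => lip_n_n h) hs
  have h2 : lip (deriv c.n s) (c.n s) = 0 := by
    rw [lip_comm (c.n s)] at h1
    linarith
  have h3 := lip_deriv_add_eq_zero c.contDiffOn_t c.contDiffOn_n (fun _ h => lip_t_n h) hs
  have h4 : lip (deriv c.n s) (c.t s) = c.κn s := by
    rw [κn, lip_comm]
    linarith
  have h5 := lip_deriv_add_eq_zero c.contDiffOn_n c.contDiffOn_b (fun _ _ => lip_n_b) hs
  have h6 : lip (deriv c.n s) (wedge (c.t s) (c.n s)) = c.τg s := by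
    rw [τg, lip_comm (deriv c.b s)]
    rw [b] at h5
    linarith
  rw [h2, h4, h6, b]
  module

/-- The Frenet-type equation for `b`. -/
theorem hasDerivAt_b (hs : s ∈ c.I) :
    HasDerivAt c.b (c.τg s • c.n s - c.κg s • c.t s) s := by
  convert! hasDerivAt_of_contDiffOn c.contDiffOn_b hs using 1
  rw [eq_frame_expansion (lip_t_t hs) (lip_n_n hs) (lip_t_n hs) (deriv c.b s)]
  have h1 := lip_deriv_add_eq_zero c.contDiffOn_b c.contDiffOn_b (fun _ h => lip_b_b h) hs
  have h2 : lip (deriv c.b s) (wedge (c.t s) (c.n s)) = 0 := by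
    rw [lip_comm (c.b s), b] at h1
    change lip (deriv c.b s) (wedge (c.t s) (c.n s)) +
      lip (deriv c.b s) (wedge (c.t s) (c.n s)) = 0 at h1
    linarith
  have h3 := lip_deriv_add_eq_zero c.contDiffOn_t c.contDiffOn_b (fun _ _ => lip_t_b) hs
  have h4 : lip (deriv c.b s) (c.t s) = -c.κg s := by
    rw [κg, lip_comm]
    linarith
  rw [h2, h4, τg]
  module

/-- The cusp criterion for the rectifying images. -/
theorem rectifying_criterion {ν l : ℝ} (hν : ν ^ 2 = 1) (hl : l ^ 2 = l) {R δ : ℝ → ℝ}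
    {D : ℝ → R31} (hR : ∀ s, R s = ν * (c.κg s ^ 2 - c.τg s ^ 2))
    (hD : ∀ s, D s = (√(R s))⁻¹ • (c.τg s • c.t s - c.κg s • c.n s) + l • c.b s)
    (hδ : ∀ s, δ s = c.κn s - ν * (c.κg s * deriv c.τg s - deriv c.κg s * c.τg s) / R s +
      l * √(R s)) {Q : Set R31} (hQ : Q = {x | x ≠ 0 ∧ lip x x = l - ν}) {s₀ : ℝ}
    (hs₀ : s₀ ∈ c.I) (hpos : 0 < R s₀) :
    (NonSingularAt D s₀ ↔ δ s₀ ≠ 0) ∧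
      (ImageLocallyCuspAt Q D s₀ ↔ δ s₀ = 0 ∧ deriv δ s₀ ≠ 0) :=
  -- The frame order is `t`, `n`, `b`: the last vector is spacelike, so `σ = 1`.
  frame_image_criterion (σ := 1) c.isOpen_I (one_pow 2) hν hl
    (fun _ h => hasDerivAt_t h) (fun s h => by simpa using hasDerivAt_n h)
    (fun s h => by simpa using hasDerivAt_b h) c.contDiffOn_t c.contDiffOn_n c.contDiffOn_b
    c.contDiffOn_κn c.contDiffOn_κg c.contDiffOn_τg (fun _ h => lip_t_t h) (fun _ h => lip_n_n h)
    (fun _ h => lip_b_b h) (fun _ h => lip_t_n h) (fun _ _ => lip_t_b) (fun _ _ => lip_n_b)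
    (fun s => by rw [hR, one_mul]) hD (fun s => by rw [hδ, one_mul]) (by rw [hQ, one_mul]) hs₀ hpos

/-- The cusp criterion for the osculating images. -/
theorem osculating_criterion {l : ℝ} (hl : l ^ 2 = l) {δ : ℝ → ℝ} {D : ℝ → R31}
    (hD : ∀ s, D s = (√(c.κn s ^ 2 + c.τg s ^ 2))⁻¹ • (c.τg s • c.t s - c.κn s • c.b s) +
      l • c.n s)
    (hδ : ∀ s, δ s = c.κg s + (c.κn s * deriv c.τg s - deriv c.κn s * c.τg s) /
      (c.κn s ^ 2 + c.τg s ^ 2) + l * √(c.κn s ^ 2 + c.τg s ^ 2))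
    {Q : Set R31} (hQ : Q = {x | x ≠ 0 ∧ lip x x = 1 - l}) {s₀ : ℝ}
    (hs₀ : s₀ ∈ c.I) (hne : (c.κn s₀, c.τg s₀) ≠ (0, 0)) :
    (NonSingularAt D s₀ ↔ δ s₀ ≠ 0) ∧
      (ImageLocallyCuspAt Q D s₀ ↔ δ s₀ = 0 ∧ deriv δ s₀ ≠ 0) := by
  have hpos : 0 < c.κn s₀ ^ 2 + c.τg s₀ ^ 2 := by
    by_cases h : c.κn s₀ = 0
    · have : c.τg s₀ ≠ 0 := fun h' => hne (by rw [h, h'])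
      positivity
    · positivity
  -- The roles of `n` and `b`, and of `κn` and `κg`, are exchanged. The last vector is now timelike,
  -- so `k² - σ τ²` is a sum of squares and `ν = 1` always.
  refine frame_image_criterion (σ := -1) (ν := 1) (x := c.t) (y := c.b) (z := c.n) (p := c.κg)
    (k := c.κn) (τ := c.τg) (R := fun s => c.κn s ^ 2 + c.τg s ^ 2)
    c.isOpen_I (by norm_num) (one_pow 2) hl
    (fun s h => by simpa [add_comm] using hasDerivAt_t h) (fun s h => ?_)
    (fun s h => ?_) c.contDiffOn_t c.contDiffOn_b c.contDiffOn_n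
    c.contDiffOn_κg c.contDiffOn_κn c.contDiffOn_τg (fun _ h => lip_t_t h)
    (fun _ h => by rw [lip_b_b h, neg_neg]) (fun _ h => lip_n_n h) (fun _ _ => lip_t_b)
    (fun _ h => lip_t_n h) (fun _ _ => by rw [lip_comm, lip_n_b])
    (fun s => by ring) hD (fun s => by rw [hδ]; ring)
    (by rw [hQ, show 1 - l = -1 * (l - 1) by ring]) hs₀ hpos
  · convert! hasDerivAt_b h using 1
    module
  · convert! hasDerivAt_n h using 1
    module

end UnitSpeedCurve

/-- Gives the surface the form shared with the lightcone, a level set without the origin; at a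
nonzero level the origin is absent anyway. -/
theorem hyperbolicPlane_eq : hyperbolicPlane = {x | x ≠ 0 ∧ lip x x = 0 - 1} := by
  ext x
  refine ⟨fun h => ⟨?_, by rw [zero_sub]; exact h⟩, fun h => by have := h.2; rwa [zero_sub] at this⟩
  rintro rfl
  have : lip 0 0 = -1 := h
  rw [lip_zero_left] at this
  norm_num at this

theorem deSitter_eq {a : ℝ} (ha : a = 1) : deSitter = {x | x ≠ 0 ∧ lip x x = a} := by
  subst ha
  ext x
  refine ⟨fun h => ⟨?_, h⟩, fun h => h.2⟩
  rintro rfl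
  have : lip 0 0 = 1 := h
  rw [lip_zero_left] at this
  norm_num at this

end LorentzDarboux

theorem theorem3p1 (M : SpacelikeSurface) (c : UnitSpeedCurve M)
    (ht : ∀ s ∈ c.I, pnorm (deriv c.t s) ≠ 0) (hb : ∀ s ∈ c.I, pnorm (deriv c.b s) ≠ 0)
    (s₀ : ℝ) (hs₀ : s₀ ∈ c.I) :
    -- (A)
    (c.κg s₀ ^ 2 > c.τg s₀ ^ 2 →
      (NonSingularAt c.DTr s₀ ↔ c.δTr s₀ ≠ 0) ∧
      (ImageLocallyCuspAt hyperbolicPlane c.DTr s₀ ↔ c.δTr s₀ = 0 ∧ deriv c.δTr s₀ ≠ 0)) ∧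
    -- (B)
    (c.τg s₀ ^ 2 > c.κg s₀ ^ 2 →
      (NonSingularAt c.DSr s₀ ↔ c.δSr s₀ ≠ 0) ∧
      (ImageLocallyCuspAt deSitter c.DSr s₀ ↔ c.δSr s₀ = 0 ∧ deriv c.δSr s₀ ≠ 0)) ∧
    -- (C)
    (c.κg s₀ ^ 2 > c.τg s₀ ^ 2 →
      (NonSingularAt c.DLr s₀ ↔ c.δLr s₀ ≠ 0) ∧
      (ImageLocallyCuspAt lightcone c.DLr s₀ ↔ c.δLr s₀ = 0 ∧ deriv c.δLr s₀ ≠ 0)) ∧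
    -- (D)
    ((c.κn s₀, c.τg s₀) ≠ (0, 0) →
      (NonSingularAt c.DSo s₀ ↔ c.δSo s₀ ≠ 0) ∧
      (ImageLocallyCuspAt deSitter c.DSo s₀ ↔ c.δSo s₀ = 0 ∧ deriv c.δSo s₀ ≠ 0)) ∧
    -- (E)
    ((c.κn s₀, c.τg s₀) ≠ (0, 0) →
      (NonSingularAt c.DLo s₀ ↔ c.δLo s₀ ≠ 0) ∧
      (ImageLocallyCuspAt lightcone c.DLo s₀ ↔ c.δLo s₀ = 0 ∧ deriv c.δLo s₀ ≠ 0)) := by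
  refine ⟨fun h => ?_, fun h => ?_, fun h => ?_, fun h => ?_, fun h => ?_⟩
  -- In the rectifying cases `ν` is the sign of `κ_g² - τ_g²`; in all cases `l` is 1 exactly for the
  -- lightlike images.
  · refine UnitSpeedCurve.rectifying_criterion (c := c) (ν := 1) (l := 0)
      (R := fun s => c.κg s ^ 2 - c.τg s ^ 2) (by norm_num) (by norm_num) (fun s => by ring)
      (fun s => ?_) (fun s => ?_) hyperbolicPlane_eq hs₀ (sub_pos.2 h)
    · simp [UnitSpeedCurve.DTr]
    · simp [UnitSpeedCurve.δTr]
  · refine UnitSpeedCurve.rectifying_criterion (c := c) (ν := -1) (l := 0)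
      (R := fun s => c.τg s ^ 2 - c.κg s ^ 2) (by norm_num) (by norm_num) (fun s => by ring)
      (fun s => ?_) (fun s => ?_) (deSitter_eq (by norm_num)) hs₀ (sub_pos.2 h)
    · simp [UnitSpeedCurve.DSr]
    · simp only [UnitSpeedCurve.δSr]
      ring
  · refine UnitSpeedCurve.rectifying_criterion (c := c) (ν := 1) (l := 1)
      (R := fun s => c.κg s ^ 2 - c.τg s ^ 2) (by norm_num) (by norm_num) (fun s => by ring)
      (fun s => ?_) (fun s => ?_) (by rw [sub_self]; rfl) hs₀ (sub_pos.2 h)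
    · simp [UnitSpeedCurve.DLr]
    · simp [UnitSpeedCurve.δLr]
  · refine UnitSpeedCurve.osculating_criterion (l := 0) (by norm_num) (fun s => ?_) (fun s => ?_)
      (deSitter_eq (by norm_num)) hs₀ h
    · simp [UnitSpeedCurve.DSo]
    · simp [UnitSpeedCurve.δSo]
  · refine UnitSpeedCurve.osculating_criterion (l := 1) (by norm_num) (fun s => ?_) (fun s => ?_)
      (by rw [sub_self]; rfl) hs₀ h
    · simp [UnitSpeedCurve.DLo]
    · simp [UnitSpeedCurve.δLo]
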